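/- Let $o$ be a complete discrete valuation ring with fraction field $E$ (for example, the ring of integers of a finite extension $E$ of $\mathbb{Q}_\ell$). An *admissible quintet* $(R,T,\pi,M,\langle\ ,\ \rangle)$ consists of a complete noetherian local $o$-algebra $R$, a finite flat $o$-algebra $T$, a surjective $o$-algebra homomorphism $\pi:R\to T$, a faithful finitely generated $T$-module $M$ which is free over $o$, and a perfect $o$-bilinear pairing $\langle\ ,\ \rangle:M\times M\to o$ with $\langle tx,y\rangle=\langle x,ty\rangle$ for all $t\in T$ and $x,y\in M$. It is *distinguished* if $R$ is a complete intersection and $M$ is a non-zero free $R$-module (via $\pi$). Here an $o$-algebra is a *complete intersection* if it is isomorphic to $o[[X_1,\dots,X_n]]/(f_1,\dots,f_m)$ for some $n\ge 0$ and some regular sequence $f_1,\dots,f_m$. An *admissible morphism* from $(R',T',\pi',M',\langle\ ,\ \rangle')$ to $(R,T,\pi,M,\langle\ ,\ \rangle)$ is a triple $(\alpha,\beta,\xi)$ of surjective $o$-algebra homomorphisms $\alpha:R'\to R$ and $\beta:T'\to T$ with $\pi\circ\alpha=\beta\circ\pi'$, and an injective $T'$-linear map $\xi:M\to M'$ (with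 $T'$ acting on $M$ via $\beta$) whose image is a direct summand of $M'$ as an $o$-module. Let $\xi^\vee:M'\to M$ be the adjoint of $\xi$, characterized by $\langle \xi(x),y\rangle'=\langle x,\xi^\vee(y)\rangle$ for all $x\in M$, $y\in M'$. **Theorem (abstract level raising formalism).** Let $(\alpha,\beta,\xi)$ be an admissible morphism of admissible quintets from $(R',T',\pi',M',\langle\ ,\ \rangle')$ to $(R,T,\pi,M,\langle\ ,\ \rangle)$. Let $f_T:T\to o$ be an $o$-algebra homomorphism, and put $f_R=f_T\circ\pi$ and $f_{R'}=f_T\circ\beta\circ\pi'$. Assume: 1. $(R,T,\pi,M,\langle\ ,\ \rangle)$ is distinguished. 2. $T$ and $T'$ are reduced, and $M'\otimes_o E$ is a free $T'\otimes_o E$-module of rank equal to $\operatorname{rank}_T M$. 3. $\xi^\vee\circ\xi(M)=\Delta\cdot M$ for a non-zero-divisor $\Delta$ of $T$. 4. For this $\Delta$, $$\operatorname{length}_o \ker f_{R'}/(\ker f_{R'})^2\ \le\ \operatorname{length}_o \ker f_R/(\ker f_R)^2+\operatorname{length}_o\, o/f_T(\Delta)o .$$ Then $(R',T',\pi',M',\langle\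 ,\ \rangle')$ is also distinguished; that is, $R'$ is a complete intersection and $M'$ is a non-zero free $R'$-module. Moreover, $\pi':R'\to T'$ is an isomorphism and $M'$ is a free $T'$-module. -/

import Mathlib

open scoped TensorProduct

universe u v₁ v₂ v₃ w₁ w₂ w₃

/-- The `O`-algebra `A` is a complete intersection: it is isomorphic to a power series ring
`O[[X₁, …, Xₙ]]` modulo the ideal generated by a regular sequence. For `O` a complete discrete
valuation ring (so that `O[[X₁, …, Xₙ]]` is a complete regular local ring) and `A` a complete
noetherian local `O`-algebra with the same residue field as `O` (for instance one that has an
`O`-algebra homomorphism to `O`), this is the usual notion for complete noetherian local rings. -/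
def IsCompleteIntersection (O : Type u) [CommRing O] (A : Type v₁) [CommRing A] [Algebra O A] :
    Prop :=
  ∃ (n : ℕ) (rs : List (MvPowerSeries (Fin n) O)),
    RingTheory.Sequence.IsRegular (MvPowerSeries (Fin n) O) rs ∧
      Nonempty ((MvPowerSeries (Fin n) O ⧸ Ideal.ofList rs) ≃ₐ[O] A)

/-- An admissible quintet `(R, T, π, M, ⟨ , ⟩)` over `O`. -/
structure AdmissibleQuintet (O : Type u) [CommRing O] [IsLocalRing O] where
  /-- The complete noetherian local `O`-algebra `R`. -/
  R : Type v₁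
  /-- The finite flat `O`-algebra `T`. -/
  T : Type v₂
  /-- The `T`-module `M`. -/
  M : Type v₃
  [commRingR : CommRing R]
  [algebraR : Algebra O R]
  [isLocalRingR : IsLocalRing R]
  [isLocalHomR : IsLocalHom (algebraMap O R)]
  [isNoetherianRingR : IsNoetherianRing R]
  [isAdicCompleteR : IsAdicComplete (IsLocalRing.maximalIdeal R) R]
  [commRingT : CommRing T]
  [algebraT : Algebra O T]
  [finiteT : Module.Finite O T]
  [flatT : Module.Flat O T]
  /-- The surjection `π : R → T`. -/
  π : R →ₐ[O] T
  π_surjective : Function.Surjective π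
  [addCommGroupM : AddCommGroup M]
  [moduleM : Module T M]
  [moduleOM : Module O M]
  [isScalarTowerM : IsScalarTower O T M]
  [finiteM : Module.Finite T M]
  [faithfulM : FaithfulSMul T M]
  [freeM : Module.Free O M]
  /-- The pairing `⟨ , ⟩ : M × M → O`. -/
  pairing : M →ₗ[O] M →ₗ[O] O
  [perfect : pairing.IsPerfPair]
  pairing_smul : ∀ (t : T) (x y : M), pairing (t • x) y = pairing x (t • y)

namespace AdmissibleQuintet

attribute [instance] commRingR algebraR isLocalRingR isLocalHomR isNoetherianRingR
  isAdicCompleteR commRingT algebraT finiteT flatT addCommGroupM moduleM moduleOM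
  isScalarTowerM finiteM faithfulM freeM perfect

variable {O : Type u} [CommRing O] [IsLocalRing O]

/-- `M` is a free `R`-module, where `R` acts on `M` through `π : R → T`. -/
def IsFreeOverR (Q : AdmissibleQuintet.{u, v₁, v₂, v₃} O) : Prop :=
  letI : Module Q.R Q.M := Module.compHom Q.M (Q.π : Q.R →+* Q.T)
  Module.Free Q.R Q.M

/-- A quintet is distinguished if `R` is a complete intersection and `M` is a non-zero free
`R`-module. -/
structure IsDistinguished (Q : AdmissibleQuintet.{u, v₁, v₂, v₃} O) : Prop where
  completeIntersection : IsCompleteIntersection O Q.R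
  nontrivial : Nontrivial Q.M
  free : Q.IsFreeOverR

/-- An admissible morphism `(α, β, ξ)` from the quintet `Q'` to the quintet `Q`. -/
structure Hom (Q' : AdmissibleQuintet.{u, w₁, w₂, w₃} O)
    (Q : AdmissibleQuintet.{u, v₁, v₂, v₃} O) where
  /-- The surjection `α : R' → R`. -/
  α : Q'.R →ₐ[O] Q.R
  /-- The surjection `β : T' → T`. -/
  β : Q'.T →ₐ[O] Q.T
  /-- The injection `ξ : M → M'`. -/
  ξ : Q.M →ₗ[O] Q'.M
  α_surjective : Function.Surjective α
  β_surjective : Function.Surjective β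
  comm : Q.π.comp α = β.comp Q'.π
  ξ_smul : ∀ (t' : Q'.T) (x : Q.M), ξ (β t' • x) = t' • ξ x
  ξ_injective : Function.Injective ξ
  ξ_directSummand : ∃ N : Submodule O Q'.M, IsCompl (LinearMap.range ξ) N

namespace Hom

variable {Q' : AdmissibleQuintet.{u, w₁, w₂, w₃} O} {Q : AdmissibleQuintet.{u, v₁, v₂, v₃} O}

/-- The adjoint `ξ^∨ : M' ≃ Hom(M', O) → Hom(M, O) ≃ M` of `ξ` with respect to the two
pairings. -/
noncomputable def ξDual (φ : Hom Q' Q) : Q'.M →ₗ[O] Q.M :=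
  Q.pairing.flip.toPerfPair.symm.toLinearMap ∘ₗ φ.ξ.dualMap ∘ₗ Q'.pairing.flip

theorem pairing_ξ (φ : Hom Q' Q) (x : Q.M) (y : Q'.M) :
    Q'.pairing (φ.ξ x) y = Q.pairing x (φ.ξDual y) := by
  have h : Q.pairing.flip.toPerfPair (φ.ξDual y) = φ.ξ.dualMap (Q'.pairing.flip y) := by
    simp [ξDual]
  have h2 := LinearMap.congr_fun h x
  simpa using h2.symm

end Hom

end AdmissibleQuintet

/-! Write `B` for the power series ring in `n` variables over `O`, `f` for the augmentation of `T'`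
through `β`, and `d` for the rank of `M` over `T`. The proof builds a complete intersection `B/(F)`
that maps onto `T'`, and shows that it acts freely on `M'`.

The length bound makes the cotangent module of `R'` a sum of cyclic modules `O/a_i`. This gives a
surjection `Θ : B → R'` and relations with linear parts `a_i X_i`. Since `T'` is finite over `O`,
these can be altered by relations of `T'` of order at least two until they form a regular sequence
`F` modulo `ϖ` (`RegSeqMod.exchange`, `exists_presentation`). Now `F` vanishes in `T'`, though
perhaps not yet in `R'`. Write `F = A X`. By Cramer's rule the image `D` of `det A` in `T'` is
killed by `ker f`, and `f(D) = ∏ a_i`.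

On the distinguished side, the same determinant for a presentation of `T` generates the annihilator
of `ker fT`. Call it `δ`; the order of `fT(δ)` is at least the length of the cotangent module of
`R`. Hence `β(D) = s δ`, and the length hypothesis becomes `s ∣ fT(Δ)`. This is the only use of the
numerical bound beyond finiteness.

Choose `m_1, …, m_d` in `M'` dual under the pairing to the `ξ(δ e_j)`, for a basis `e` of `M`. If `∑
c_i D m_i` lies in `ϖ M'`, then the quotient by `ϖ` lies in `ξ(M)`. Applying `ξ^∨` and pairing with
`e_l` gives `ϖ fT(Δ) ∣ s c_l`, so `ϖ ∣ c_l` (`dvd_of_sum_smul_eq_smul`). Since `det A` spans the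
socle of the Artinian ring `B/(ϖ, F)` (`RegSeqMod.mem_sup_span_det`), this says that `(B/(ϖ, F))^d →
M'/ϖ` is injective on the socle, hence injective. Nakayama and torsion-freeness lift this to
`(B/(F))^d → M'`, with `ϖ`-saturated image; the generic rank makes it onto. So `T' = B/(F)` and `M'`
is free. Finally the relations of `R'` agree with `F` to first order and lie in `(F)`; since every
`a_i` is nonzero, Nakayama shows that they generate `(F)`, so `R' = T'`. -/

section

/-! ### Regular sequences modulo an ideal, exchange, and the determinant of a change of generators.
-/

namespace Ideal

open IsLocalRing

variable {B : Type*} [CommRing B]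

/-- `x` is a nonzerodivisor modulo `I`. -/
def RegMod (I : Ideal B) (x : B) : Prop :=
  ∀ b, x * b ∈ I → b ∈ I

/-- `xs` is a weakly regular sequence modulo `I`. -/
def RegSeqMod : Ideal B → List B → Prop
  | _, [] => True
  | I, x :: xs => RegMod I x ∧ RegSeqMod (I ⊔ span {x}) xs

theorem RegMod.of_sub_mem {I : Ideal B} {x y : B} (hx : RegMod I x) (h : x - y ∈ I) :
    RegMod I y := by
  intro b hb
  apply hx
  have : x * b = (x - y) * b + y * b := by ring
  rw [this]
  exact I.add_mem (I.mul_mem_right _ h) hb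

theorem RegMod.pow {I : Ideal B} {x : B} (hx : RegMod I x) (k : ℕ) : RegMod I (x ^ k) := by
  induction k with
  | zero => intro b hb; simpa using hb
  | succ k ih =>
    intro b hb
    apply hx
    apply ih
    rwa [← mul_assoc, ← pow_succ]

theorem regSeqMod_append {I : Ideal B} {xs ys : List B} :
    RegSeqMod I (xs ++ ys) ↔ RegSeqMod I xs ∧ RegSeqMod (I ⊔ ofList xs) ys := by
  induction xs generalizing I with
  | nil => simp [RegSeqMod]
  | cons x xs ih => simp [RegSeqMod, ih, ofList_cons, and_assoc, sup_assoc]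

theorem regSeqMod_concat {I : Ideal B} {xs : List B} {x : B} :
    RegSeqMod I (xs ++ [x]) ↔ RegSeqMod I xs ∧ RegMod (I ⊔ ofList xs) x := by
  simp [regSeqMod_append, RegSeqMod]

theorem regSeqMod_iff_getElem {I : Ideal B} {xs : List B} :
    RegSeqMod I xs ↔ ∀ (i : ℕ) (h : i < xs.length), RegMod (I ⊔ ofList (xs.take i)) xs[i] := by
  induction xs generalizing I with
  | nil => simp [RegSeqMod]
  | cons x xs ih =>
    simp only [RegSeqMod, ih]
    constructor
    · rintro ⟨h0, h⟩ i hi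
      cases i with
      | zero => simpa using h0
      | succ i =>
        have := h i (by simpa using hi)
        simpa [ofList_cons, sup_assoc] using this
    · intro h
      have h0 := h 0 (by simp)
      rw [List.getElem_cons_zero] at h0
      refine ⟨by simpa using h0, fun i hi ↦ ?_⟩
      have := h (i + 1) (by simpa using hi)
      simpa [ofList_cons, sup_assoc] using this

theorem isWeaklyRegular_iff_regSeqMod {xs : List B} :
    RingTheory.Sequence.IsWeaklyRegular B xs ↔ RegSeqMod ⊥ xs := by
  rw [RingTheory.Sequence.isWeaklyRegular_iff, regSeqMod_iff_getElem]
  refine forall₂_congr fun i h ↦ ?_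
  rw [isSMulRegular_quotient_iff_mem_of_smul_mem]
  simp [RegMod]

theorem mem_sup_span_singleton_iff {I : Ideal B} {x b : B} :
    b ∈ I ⊔ span {x} ↔ ∃ c, b - c * x ∈ I := by
  rw [Submodule.mem_sup]
  constructor
  · rintro ⟨i, hi, z, hz, rfl⟩
    obtain ⟨c, rfl⟩ := mem_span_singleton'.1 hz
    exact ⟨c, by simpa using hi⟩
  · rintro ⟨c, hc⟩
    exact ⟨_, hc, c * x, mem_span_singleton'.2 ⟨c, rfl⟩, by ring⟩

/-- A finite set of primes, none of which contains `(x) + K`, does not cover the coset `x + K`. -/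
theorem exists_add_notMem_of_not_le (S : Finset (Ideal B)) (hS : ∀ p ∈ S, p.IsPrime) (x : B)
    (K : Ideal B) (h : ∀ p ∈ S, ¬ span {x} ⊔ K ≤ p) : ∃ z ∈ K, ∀ p ∈ S, x + z ∉ p := by
  classical
  induction hn : S.card generalizing S with
  | zero =>
    rw [Finset.card_eq_zero] at hn
    exact ⟨0, K.zero_mem, by simp [hn]⟩
  | succ n ih =>
    -- Minimality of `p` means that no other member of `S` is contained in `p`, so the product of
    -- the others contains elements outside `p`.
    obtain ⟨p, hp⟩ := S.exists_minimal (Finset.card_pos.1 (by omega))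
    obtain ⟨z, hz, hzS⟩ := ih (S.erase p) (fun q hq ↦ hS q (Finset.mem_of_mem_erase hq))
      (fun q hq ↦ h q (Finset.mem_of_mem_erase hq)) (by rw [Finset.card_erase_of_mem hp.1]; omega)
    by_cases hzp : x + z ∈ p
    · have hpP := hS p hp.1
      have hK : ¬ K ≤ p := by
        intro hK
        apply h p hp.1
        rw [sup_le_iff, span_singleton_le_iff_mem]
        exact ⟨(p.add_mem_iff_left (hK hz)).1 hzp, hK⟩
      have hprod : ¬ K * (S.erase p).prod id ≤ p := by
        rw [hpP.mul_le]
        rintro (h1 | h1)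
        · exact hK h1
        · obtain ⟨q, hq, hqp⟩ := hpP.prod_le.1 h1
          have hpq := hp.2 (Finset.mem_of_mem_erase hq) hqp
          exact Finset.ne_of_mem_erase hq (le_antisymm hqp hpq)
      obtain ⟨w, hw, hwp⟩ := Set.not_subset.1 hprod
      have hmul : K * (S.erase p).prod id ≤ K := Ideal.mul_le_left
      have hwK : w ∈ K := hmul hw
      refine ⟨z + w, K.add_mem hz hwK, fun q hq ↦ ?_⟩
      rw [← add_assoc]
      by_cases hqp : q = p
      · subst hqp
        rwa [q.add_mem_iff_right hzp]
      · have hq' : q ∈ S.erase p := Finset.mem_erase.2 ⟨hqp, hq⟩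
        have hle : (S.erase p).prod id ≤ q := prod_le_inf.trans (Finset.inf_le (f := id) hq')
        have hmul : K * (S.erase p).prod id ≤ q := Ideal.mul_le_right.trans hle
        have hwq : w ∈ q := hmul hw
        rw [q.add_mem_iff_left hwq]
        exact hzS q hq'
    · refine ⟨z, hz, fun q hq ↦ ?_⟩
      by_cases hqp : q = p
      · rwa [hqp]
      · exact hzS q (Finset.mem_erase.2 ⟨hqp, hq⟩)

/-- If the ideal `I + (x) + K` contains a nonzerodivisor modulo `I`, then so does `x + K`. -/
theorem RegMod.exists_add [IsNoetherianRing B] {I K : Ideal B} {f x : B} (hf : RegMod I f)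
    (hmem : f ∈ I ⊔ span {x} ⊔ K) : ∃ z ∈ K, RegMod I (x + z) := by
  have hfin := associatedPrimes.finite B (B ⧸ I)
  have hreg : ∀ y, RegMod I y ↔ ∀ p ∈ associatedPrimes B (B ⧸ I), y ∉ p := by
    intro y
    have h1 : RegMod I y ↔ IsSMulRegular (B ⧸ I) y := by
      rw [isSMulRegular_quotient_iff_mem_of_smul_mem]; rfl
    have h2 := Set.ext_iff.1 (biUnion_associatedPrimes_eq_compl_regular B (B ⧸ I)) y
    simp only [Set.mem_iUnion, Set.mem_compl_iff, Set.mem_ofPred_eq, SetLike.mem_coe] at h2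
    rw [h1, ← not_iff_not, ← h2]
    push Not
    simp
  have hIp : ∀ p ∈ associatedPrimes B (B ⧸ I), I ≤ p := by
    intro p hp
    have := (show IsAssociatedPrime p (B ⧸ I) from hp).annihilator_le
    rwa [Submodule.annihilator_top, annihilator_quotient] at this
  obtain ⟨z, hz, h⟩ := exists_add_notMem_of_not_le hfin.toFinset
    (fun p hp ↦ ((hfin.mem_toFinset.1 hp) : IsAssociatedPrime p (B ⧸ I)).isPrime) x K
    (fun p hp hle ↦ by
      have hp' := hfin.mem_toFinset.1 hp
      refine (hreg f).1 hf p hp' ?_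
      have : I ⊔ span {x} ⊔ K ≤ p := by
        rw [sup_assoc]
        exact sup_le (hIp p hp') hle
      exact this hmem)
  exact ⟨z, hz, (hreg _).2 fun p hp ↦ h p (hfin.mem_toFinset.2 hp)⟩

theorem ofList_le {I : Ideal B} {xs : List B} : ofList xs ≤ I ↔ ∀ x ∈ xs, x ∈ I := by
  rw [ofList, span_le]; rfl

theorem ofList_le_sup_of_forall₂ {K : Ideal B} {xs ys : List B}
    (h : List.Forall₂ (fun x y ↦ x - y ∈ K) xs ys) : ofList ys ≤ ofList xs ⊔ K := by
  induction h with
  | nil => simp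
  | @cons x y xs ys hxy _ ih =>
    rw [ofList_cons, ofList_cons, sup_le_iff, span_singleton_le_iff_mem]
    refine ⟨?_, ih.trans (by rw [sup_assoc]; exact le_sup_right)⟩
    have : y = x - (x - y) := by ring
    rw [this]
    exact sub_mem (mem_sup_left (mem_sup_left (mem_span_singleton_self x))) (mem_sup_right hxy)

theorem ofList_ofFn {n : ℕ} (f : Fin n → B) : ofList (List.ofFn f) = span (Set.range f) := by
  rw [ofList]
  congr 1
  ext x
  exact List.mem_ofFn' f x

section Local

variable [IsNoetherianRing B] [IsLocalRing B]

/-- That `y` is regular modulo `I` is where locality enters: regularity of `x` and then `y` gives `K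
⊆ I + xK` for `K = (I : y)`, so `K ⊆ I` by Nakayama. -/
theorem RegSeqMod.swap {I : Ideal B} {x y : B} {zs : List B} (hx : x ∈ maximalIdeal B)
    (h : RegSeqMod I (x :: y :: zs)) : RegSeqMod I (y :: x :: zs) := by
  obtain ⟨h1, h2, h3⟩ := h
  refine ⟨?_, ?_, ?_⟩
  · let K : Ideal B := I.colon {y}
    have hK : ∀ b, b ∈ K ↔ y * b ∈ I := fun b ↦ by
      simp [K, Submodule.mem_colon_singleton, mul_comm]
    have key : K ≤ I ⊔ maximalIdeal B • K := by
      intro b hb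
      rw [hK] at hb
      have hb' := h2 b (le_sup_left (a := I) hb)
      obtain ⟨c, hc⟩ := mem_sup_span_singleton_iff.1 hb'
      have hcK : c ∈ K := by
        rw [hK]
        apply h1
        have : x * (y * c) = y * b - y * (b - c * x) := by ring
        rw [this]
        exact I.sub_mem hb (I.mul_mem_left _ hc)
      have : b = (b - c * x) + x • c := by simp; ring
      rw [this]
      exact Submodule.add_mem_sup hc (Submodule.smul_mem_smul hx hcK)
    have hle : K ≤ I := Submodule.le_of_le_smul_of_le_jacobson_bot
      (IsNoetherian.noetherian K) (maximalIdeal_le_jacobson _) key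
    exact fun b hb ↦ hle ((hK b).2 hb)
  · intro b hb
    obtain ⟨c, hc⟩ := mem_sup_span_singleton_iff.1 hb
    have h4 : c ∈ I ⊔ span {x} := by
      apply h2
      rw [mem_sup_span_singleton_iff]
      refine ⟨b, ?_⟩
      have : y * c - b * x = -(x * b - c * y) := by ring
      rw [this]
      exact I.neg_mem hc
    obtain ⟨e, he⟩ := mem_sup_span_singleton_iff.1 h4
    rw [mem_sup_span_singleton_iff]
    refine ⟨e, h1 _ ?_⟩
    have : x * (b - e * y) = (x * b - c * y) + y * (c - e * x) := by ring
    rw [this]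
    exact I.add_mem hc (I.mul_mem_left _ he)
  · rwa [sup_right_comm]

theorem RegSeqMod.perm {I : Ideal B} {xs ys : List B} (hp : xs.Perm ys)
    (hm : ∀ x ∈ xs, x ∈ maximalIdeal B) (h : RegSeqMod I xs) : RegSeqMod I ys := by
  induction hp generalizing I with
  | nil => exact h
  | cons x _ ih => exact ⟨h.1, ih (fun z hz ↦ hm z (List.mem_cons_of_mem _ hz)) h.2⟩
  | swap x y l => exact h.swap (hm _ (by simp))
  | trans h1 _ ih1 ih2 => exact ih2 (fun z hz ↦ hm z (h1.mem_iff.2 hz)) (ih1 hm h)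

theorem RegSeqMod.concat_of_cons {I : Ideal B} {x : B} {xs : List B} (hx : x ∈ maximalIdeal B)
    (hm : ∀ x ∈ xs, x ∈ maximalIdeal B) (h : RegSeqMod I (x :: xs)) :
    RegSeqMod I xs ∧ RegMod (I ⊔ ofList xs) x := by
  rw [← regSeqMod_concat]
  exact h.perm (List.perm_append_singleton x xs).symm (by simpa using ⟨hx, hm⟩)

theorem RegSeqMod.cons_of_concat {I : Ideal B} {x : B} {xs : List B} (hx : x ∈ maximalIdeal B)
    (hm : ∀ x ∈ xs, x ∈ maximalIdeal B) (h : RegSeqMod I xs) (h' : RegMod (I ⊔ ofList xs) x) :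
    RegSeqMod I (x :: xs) := by
  refine (regSeqMod_concat.2 ⟨h, h'⟩).perm (List.perm_append_singleton x xs) ?_
  intro z hz
  rcases List.mem_append.1 hz with hz | hz
  · exact hm z hz
  · rwa [List.mem_singleton.1 hz]

/-- The last element of a regular sequence can plainly be replaced by a power, and permutability
lets each element be last. -/
theorem RegSeqMod.pow {I : Ideal B} {xs : List B} (hm : ∀ x ∈ xs, x ∈ maximalIdeal B) {k : ℕ}
    (hk : k ≠ 0) (h : RegSeqMod I xs) : RegSeqMod I (xs.map (· ^ k)) := by
  induction xs generalizing I with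
  | nil => trivial
  | cons x xs ih =>
    simp only [List.mem_cons, forall_eq_or_imp] at hm
    have hpow : ∀ y ∈ xs.map (· ^ k), y ∈ maximalIdeal B := by
      intro y hy
      obtain ⟨z, hz, rfl⟩ := List.mem_map.1 hy
      exact pow_mem_of_mem _ (hm.2 z hz) _ (Nat.pos_of_ne_zero hk)
    have h1 : RegSeqMod I (x :: xs.map (· ^ k)) := ⟨h.1, ih hm.2 h.2⟩
    obtain ⟨h2, h3⟩ := h1.concat_of_cons hm.1 hpow
    exact h2.cons_of_concat (pow_mem_of_mem _ hm.1 _ (Nat.pos_of_ne_zero hk)) hpow (h3.pow k)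

/-- If `I + (ys) + K` contains a regular sequence modulo `I` of the same length as `ys`, then
the elements of `ys` can be changed by elements of `K` so that they form a regular sequence. -/
theorem RegSeqMod.exchange {I K : Ideal B} {gs ys : List B} (hI : I ≤ maximalIdeal B)
    (hK : K ≤ maximalIdeal B) (hys : ∀ y ∈ ys, y ∈ maximalIdeal B) (hgs : RegSeqMod I gs)
    (hlen : gs.length = ys.length) (hmem : ∀ g ∈ gs, g ∈ I ⊔ ofList ys ⊔ K) :
    ∃ zs, List.Forall₂ (fun z y ↦ z - y ∈ K) zs ys ∧ RegSeqMod I zs := by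
  induction ys generalizing I gs with
  | nil => exact ⟨[], .nil, trivial⟩
  | cons y ys ih =>
    have htot : I ⊔ ofList (y :: ys) ⊔ K ≤ maximalIdeal B :=
      sup_le (sup_le hI (ofList_le.2 hys)) hK
    obtain ⟨g, gs, rfl⟩ := List.exists_cons_of_length_eq_add_one hlen
    simp only [List.mem_cons, forall_eq_or_imp] at hmem hys
    have hgm : ∀ g ∈ gs, g ∈ maximalIdeal B := fun g hg ↦ htot (hmem.2 g hg)
    obtain ⟨h1, h2⟩ := hgs.concat_of_cons (htot hmem.1) hgm
    have hgmem : g ∈ I ⊔ ofList gs ⊔ span {y} ⊔ (ofList ys ⊔ K) := by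
      refine (?_ : I ⊔ ofList (y :: ys) ⊔ K ≤ _) hmem.1
      rw [ofList_cons]
      refine sup_le (sup_le ?_ (sup_le ?_ ?_)) ?_
      · exact le_sup_left.trans (le_sup_left.trans le_sup_left)
      · exact le_sup_right.trans le_sup_left
      · exact le_sup_left.trans le_sup_right
      · exact le_sup_right.trans le_sup_right
    -- With `g` moved to the end, `g` is regular modulo `I + (gs)`. Prime avoidance trades it for `y
    -- + z`, which then returns to the front as the base of the recursion.
    obtain ⟨z, hz, hreg⟩ := h2.exists_add hgmem
    have hzm : z ∈ maximalIdeal B := sup_le (ofList_le.2 hys.2) hK hz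
    have hym : y + z ∈ maximalIdeal B := add_mem hys.1 hzm
    have h3 := h1.cons_of_concat hym hgm hreg
    have hyle : span {y} ≤ span {y + z} ⊔ (ofList ys ⊔ K) := by
      rw [span_singleton_le_iff_mem]
      have h := sub_mem (mem_sup_left (mem_span_singleton_self (y + z)))
        (mem_sup_right (S := span {y + z}) hz)
      rwa [add_sub_cancel_right] at h
    obtain ⟨zs, hzs, hzreg⟩ := ih (I := I ⊔ span {y + z}) (gs := gs)
      (sup_le hI ((span_singleton_le_iff_mem _).2 hym)) hys.2 h3.2 (by simpa using hlen)
      (fun g' hg' ↦ by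
        refine (?_ : I ⊔ ofList (y :: ys) ⊔ K ≤ _) (hmem.2 g' hg')
        rw [ofList_cons]
        refine sup_le (sup_le ?_ (sup_le (hyle.trans ?_) ?_)) ?_
        · exact le_sup_left.trans (le_sup_left.trans le_sup_left)
        · rw [sup_assoc I, sup_assoc I, sup_assoc]
          exact le_sup_right
        · exact le_sup_right.trans le_sup_left
        · exact le_sup_right)
    have hzK : z ∈ ofList zs ⊔ K :=
      (sup_le (ofList_le_sup_of_forall₂ hzs) le_sup_right : ofList ys ⊔ K ≤ _) hz
    -- So far `z` lies only in `(ys) + K`. Its part `w` in `(zs)` can be dropped once `y + z` is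
    -- tested last, modulo `(zs)`, leaving a correction `k` in `K`.
    obtain ⟨w, hw, k, hk, rfl⟩ := Submodule.mem_sup.1 hzK
    have hzsm : ∀ x ∈ zs, x ∈ maximalIdeal B := by
      intro x hx
      obtain ⟨i, hi, rfl⟩ := List.mem_iff_getElem.1 hx
      have h5 := hzs.get hi (hzs.length_eq ▸ hi)
      have h6 := hys.2 (ys.get ⟨i, hzs.length_eq ▸ hi⟩) (List.get_mem _ _)
      have h7 := add_mem (hK h5) h6
      simpa using h7
    obtain ⟨h8, h9⟩ := RegSeqMod.concat_of_cons (I := I) (xs := zs) hym hzsm ⟨h3.1, hzreg⟩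
    refine ⟨(y + k) :: zs, .cons (by simpa using hk) hzs,
      h8.cons_of_concat (add_mem hys.1 (hK hk)) hzsm (h9.of_sub_mem ?_)⟩
    have : y + (w + k) - (y + k) = w := by ring
    rw [this]
    exact mem_sup_right hw

/-- A regular sequence contained in an ideal generated by `n` elements has length at most `n`. -/
theorem RegSeqMod.length_le {I : Ideal B} {gs ys : List B} (hI : I ≤ maximalIdeal B)
    (hys : ∀ y ∈ ys, y ∈ maximalIdeal B) (hgs : RegSeqMod I gs)
    (hmem : ∀ g ∈ gs, g ∈ I ⊔ ofList ys) : gs.length ≤ ys.length := by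
  by_contra! hlt
  obtain ⟨k, hk⟩ := Nat.exists_eq_add_of_lt hlt
  have hle : ofList ys ≤ ofList (ys ++ List.replicate (k + 1) 0) := by
    rw [ofList_append]; exact le_sup_left
  -- Exchange with `K = ⊥` permits no change, so `ys` padded by zeros would itself be regular; but
  -- `0` is not regular modulo a proper ideal.
  obtain ⟨zs, hzs, hreg⟩ := hgs.exchange (K := ⊥) (ys := ys ++ List.replicate (k + 1) 0) hI bot_le
    (by
      intro y hy
      rcases List.mem_append.1 hy with hy | hy
      · exact hys y hy
      · rw [List.eq_of_mem_replicate hy]; exact zero_mem _)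
    (by simp [hk]; ring) (fun g hg ↦ mem_sup_left (sup_le_sup_left hle _ (hmem g hg)))
  have heq : zs = ys ++ List.replicate (k + 1) 0 := by
    have : List.Forall₂ Eq zs (ys ++ List.replicate (k + 1) 0) := by
      refine hzs.imp fun a b hab ↦ ?_
      simpa [sub_eq_zero] using hab
    rwa [List.forall₂_eq_eq_eq] at this
  rw [heq, regSeqMod_append, List.replicate_succ] at hreg
  have h1 := hreg.2.1 1 (by simp)
  have h2 : I ⊔ ofList ys ≤ maximalIdeal B := sup_le hI (ofList_le.2 hys)
  exact (maximalIdeal.isMaximal B).ne_top ((eq_top_iff_one _).2 (h2 h1))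

/-- Let `f` be a regular sequence modulo `I` with `f ≡ A y` modulo `I` for a square matrix `A`.
Then everything that multiplies the `y j` into `I + (f)` lies in `I + (f) + (det A)`. -/
theorem RegSeqMod.mem_sup_span_det {n : ℕ} {I : Ideal B} {f y : Fin n → B}
    (hI : I ≤ maximalIdeal B) (hfm : ∀ i, f i ∈ maximalIdeal B) (hym : ∀ i, y i ∈ maximalIdeal B)
    (hf : RegSeqMod I (List.ofFn f)) (A : Matrix (Fin n) (Fin n) B)
    (hA : ∀ i, f i - ∑ j, A i j * y j ∈ I) {t : B}
    (ht : ∀ j, t * y j ∈ I ⊔ span (Set.range f)) :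
    t ∈ I ⊔ span (Set.range f) ⊔ span {A.det} := by
  induction n generalizing I t with
  | zero => simp
  | succ n ih =>
    have hft : ∀ x ∈ List.ofFn (fun i : Fin n ↦ f i.succ), x ∈ maximalIdeal B := by
      intro x hx
      obtain ⟨i, rfl⟩ := (List.mem_ofFn' _ _).1 hx
      exact hfm _
    rw [List.ofFn_succ] at hf
    obtain ⟨hreg, hreg0⟩ := hf.concat_of_cons (hfm 0) hft
    rw [ofList_ofFn] at hreg0
    set ft : Fin n → B := fun i ↦ f i.succ with hftdef
    set J : Ideal B := I ⊔ span (Set.range ft) with hJ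
    have hIJ : I ≤ J := le_sup_left
    have hftJ : ∀ i : Fin n, f i.succ ∈ J := fun i ↦
      mem_sup_right (subset_span ⟨i, rfl⟩)
    have hJf : I ⊔ span (Set.range f) = J ⊔ span {f 0} := by
      have : span (Set.range f) = span {f 0} ⊔ span (Set.range ft) := by
        rw [← span_union, Set.singleton_union]
        congr 1
        exact Fin.range_fin_succ f
      rw [this, hJ, sup_assoc, sup_comm (span {f 0})]
    have hf0 : f 0 ∈ J ⊔ span {y 0} ⊔ span (Set.range fun i : Fin n ↦ y i.succ) := by
      have h1 : f 0 = (f 0 - ∑ j, A 0 j * y j) + (A 0 0 * y 0 + ∑ j : Fin n, A 0 j.succ * y j.succ)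
          := by rw [Fin.sum_univ_succ]; ring
      rw [h1]
      refine add_mem (mem_sup_left (mem_sup_left (hIJ (hA 0)))) (add_mem ?_ (_root_.sum_mem fun j _ ↦ ?_))
      · exact mem_sup_left (mem_sup_right (mul_mem_left _ _ (mem_span_singleton_self _)))
      · exact mem_sup_right (mul_mem_left _ _ (subset_span ⟨j, rfl⟩))
    -- Here `y 0` is changed by a combination of the other `y`'s so as to be regular modulo the tail
    -- of `f`. The matrix `A'` absorbs this by column operations, which keep the determinant.
    obtain ⟨z, hz, hzreg⟩ := hreg0.exists_add hf0
    obtain ⟨c, rfl⟩ := mem_span_range_iff_exists_fun.1 hz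
    set y0 : B := y 0 + ∑ i : Fin n, c i * y i.succ with hy0
    have hy0m : y0 ∈ maximalIdeal B :=
      add_mem (hym 0) (_root_.sum_mem fun i _ ↦ mul_mem_left _ _ (hym _))
    set A' : Matrix (Fin (n + 1)) (Fin (n + 1)) B :=
      Matrix.of fun i ↦ Fin.cons (A i 0) (fun j : Fin n ↦ A i j.succ - A i 0 * c j) with hA'
    have hdet : A.det = A'.det := by
      rw [← Matrix.det_transpose A, ← Matrix.det_transpose A']
      refine Matrix.det_eq_of_forall_row_eq_smul_add_const (Fin.cons 0 c) 0 rfl fun i j ↦ ?_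
      refine Fin.cases ?_ (fun i ↦ ?_) i <;> simp [hA', mul_comm]
    set y' : Fin (n + 1) → B := Fin.cons y0 (fun i ↦ y i.succ) with hy'
    have hA'y : ∀ i, f i - ∑ j, A' i j * y' j ∈ I := by
      intro i
      have : ∑ j, A' i j * y' j = ∑ j, A i j * y j := by
        simp only [Fin.sum_univ_succ, hA', hy', Matrix.of_apply, Fin.cons_zero, Fin.cons_succ,
          hy0, mul_add, sub_mul, Finset.sum_sub_distrib, Finset.mul_sum, mul_assoc]
        ring
      rw [this]
      exact hA i
    have hty : ∀ j, t * y' j ∈ J ⊔ span {f 0} := by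
      intro j
      rw [← hJf]
      refine Fin.cases ?_ (fun j ↦ ?_) j
      · simp only [hy', Fin.cons_zero, hy0, mul_add, Finset.mul_sum]
        refine add_mem (ht 0) (_root_.sum_mem fun i _ ↦ ?_)
        rw [mul_left_comm]
        exact mul_mem_left _ _ (ht _)
      · exact ht _
    -- The quotient `s` in `t y0 ≡ s f0` satisfies the hypothesis of the induction modulo `I +
    -- (y0)`, for the minor of `A'` without row and column zero.
    obtain ⟨s, hs⟩ := mem_sup_span_singleton_iff.1 (hty 0)
    have h3 := hreg.cons_of_concat hy0m hft (by rwa [ofList_ofFn])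
    have hJy : I ⊔ span {y0} ⊔ span (Set.range ft) = J ⊔ span {y0} := by
      rw [hJ, sup_right_comm]
    have hst := ih (I := I ⊔ span {y0}) (f := ft) (y := fun i ↦ y i.succ) (t := s)
      (sup_le hI ((span_singleton_le_iff_mem _).2 hy0m)) (fun i ↦ hfm _) (fun i ↦ hym _) h3.2
      (A'.submatrix Fin.succ Fin.succ)
      (fun i ↦ by
        have h4 := hA'y i.succ
        rw [Fin.sum_univ_succ] at h4
        rw [mem_sup_span_singleton_iff]
        refine ⟨A' i.succ 0, ?_⟩
        convert h4 using 1
        simp only [hy', Fin.cons_zero, Fin.cons_succ, Matrix.submatrix_apply, hftdef]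
        ring)
      (fun j ↦ by
        rw [hJy]
        obtain ⟨sj, hsj⟩ := mem_sup_span_singleton_iff.1 (hty j.succ)
        rw [mem_sup_span_singleton_iff]
        refine ⟨sj, hreg0 _ ?_⟩
        have : f 0 * (s * y j.succ - sj * y0)
            = y0 * (t * y' j.succ - sj * f 0) - y j.succ * (t * y' 0 - s * f 0) := by
          simp only [hy', Fin.cons_zero, Fin.cons_succ]
          ring
        rw [this]
        exact sub_mem (mul_mem_left _ _ hsj) (mul_mem_left _ _ hs))
    rw [hJy] at hst
    set d' : B := (A'.submatrix Fin.succ Fin.succ).det with hd'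
    obtain ⟨u, hu⟩ := mem_sup_span_singleton_iff.1 hst
    obtain ⟨v, hv⟩ := mem_sup_span_singleton_iff.1 hu
    -- Cramer's rule turns the minor `d'` produced by the induction back into the full determinant,
    -- after which `y0` can be cancelled.
    have hcramer : A'.det * y0 - d' * f 0 ∈ J := by
      have h5 : A'.adjugate.mulVec (A'.mulVec y') 0 = A'.det * y0 := by
        rw [Matrix.mulVec_mulVec, Matrix.adjugate_mul, Matrix.smul_mulVec, Matrix.one_mulVec]
        simp [hy']
      have h6 : A'.adjugate 0 0 = d' := by
        rw [Matrix.adjugate_fin_succ_eq_det_submatrix]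
        simp [hd']
      rw [← h5, ← h6]
      simp only [Matrix.mulVec, dotProduct]
      have h7 : ∑ i, A'.adjugate 0 i * ∑ j, A' i j * y' j - A'.adjugate 0 0 * f 0 =
          ∑ i : Fin n, A'.adjugate 0 i.succ * f i.succ -
            ∑ i, A'.adjugate 0 i * (f i - ∑ j, A' i j * y' j) := by
        simp only [mul_sub, Finset.sum_sub_distrib]
        rw [Fin.sum_univ_succ (fun i ↦ A'.adjugate 0 i * f i)]
        ring
      rw [h7]
      exact sub_mem (_root_.sum_mem fun i _ ↦ mul_mem_left _ _ (hftJ i))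
        (_root_.sum_mem fun i _ ↦ mul_mem_left _ _ (hIJ (hA'y i)))
    rw [hJf, hdet]
    have hfin : t - u * A'.det - v * f 0 ∈ J := by
      apply hzreg
      have : y0 * (t - u * A'.det - v * f 0) = (t * y' 0 - s * f 0)
          - u * (A'.det * y0 - d' * f 0) + f 0 * (s - u * d' - v * y0) := by
        simp only [hy', Fin.cons_zero]
        ring
      rw [this]
      exact add_mem (sub_mem hs (mul_mem_left _ _ hcramer)) (mul_mem_left _ _ hv)
    exact mem_sup_span_singleton_iff.2 ⟨u, mem_sup_span_singleton_iff.2 ⟨v, hfin⟩⟩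

end Local

end Ideal

end

section

/-! ### Power series over `O`: coordinate ideals, augmentations and evaluation. -/

namespace MvPowerSeries

open IsLocalRing Ideal

section Coeff

variable {σ A : Type*} [CommRing A]

/-- Membership in the ideal generated by a constant and some of the variables. -/
theorem mem_span_C_sup_span_X_iff [DecidableEq σ] {c : A} {s : Finset σ} {F : MvPowerSeries σ A} :
    F ∈ span {C c} ⊔ span (X '' (s : Set σ)) ↔
      ∀ e : σ →₀ ℕ, (∀ i ∈ s, e i = 0) → c ∣ coeff e F := by
  constructor
  · intro hF e he
    obtain ⟨a, ha, b, hb, rfl⟩ := Submodule.mem_sup.1 hF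
    obtain ⟨g, rfl⟩ := mem_span_singleton'.1 ha
    rw [map_add, mul_comm, coeff_C_mul]
    refine dvd_add (Dvd.intro _ rfl) ?_
    suffices coeff e b = 0 by rw [this]; exact dvd_zero _
    clear hF ha
    induction hb using Submodule.span_induction generalizing e with
    | mem x hx =>
      obtain ⟨i, hi, rfl⟩ := hx
      rw [coeff_X, if_neg]
      rintro rfl
      simpa using he i hi
    | zero => simp
    | add x y _ _ hx hy => rw [map_add, hx e he, hy e he, add_zero]
    | smul a x _ hx =>
      rw [smul_eq_mul, coeff_mul]
      refine Finset.sum_eq_zero fun p hp ↦ ?_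
      rw [hx p.2, mul_zero]
      intro i hi
      have h := he i hi
      rw [← Finset.HasAntidiagonal.mem_antidiagonal.1 hp, Finsupp.add_apply] at h
      omega
  · intro h
    induction s using Finset.induction_on generalizing F with
    | empty =>
      choose g hg using fun e ↦ h e (by simp)
      let G : MvPowerSeries σ A := g
      refine mem_sup_left (mem_span_singleton.2 ⟨G, ?_⟩)
      ext e
      rw [hg, coeff_C_mul]
      rfl
    | @insert i s hi ih =>
      let F₁ : MvPowerSeries σ A := fun e ↦ if e i = 0 then coeff e F else 0
      have hF₁ : ∀ e, coeff e F₁ = if e i = 0 then coeff e F else 0 := fun e ↦ rfl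
      have h1 : F - F₁ ∈ span {C c} ⊔ span (X '' ((insert i s : Finset σ) : Set σ)) := by
        obtain ⟨g, hg⟩ : X i ∣ F - F₁ := by
          rw [X_dvd_iff]
          intro m hm
          rw [map_sub, hF₁, if_pos hm, sub_self]
        rw [hg]
        exact mem_sup_right (mul_mem_right _ _ (subset_span ⟨i, by simp, rfl⟩))
      have h2 : F₁ ∈ span {C c} ⊔ span (X '' (s : Set σ)) := by
        apply ih
        intro e he
        rw [hF₁]
        split_ifs with hei
        · exact h e (by simpa using ⟨hei, he⟩)
        · exact dvd_zero _
      have h3 : span {C c} ⊔ span (X '' (s : Set σ)) ≤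
          span {C c} ⊔ span (X '' ((insert i s : Finset σ) : Set σ)) :=
        sup_le_sup_left (span_mono (Set.image_mono (by simp))) _
      have := add_mem h1 (h3 h2)
      rwa [sub_add_cancel] at this

theorem mem_span_C_sup_span_range_X_iff [Fintype σ] {c : A} {F : MvPowerSeries σ A} :
    F ∈ span {C c} ⊔ span (Set.range X) ↔ c ∣ constantCoeff F := by
  classical
  have := mem_span_C_sup_span_X_iff (c := c) (s := Finset.univ) (F := F)
  rw [Finset.coe_univ, Set.image_univ] at this
  rw [this]
  constructor
  · intro h; simpa using h 0 (by simp)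
  · intro h e he
    have : e = 0 := by ext i; simpa using he i (by simp)
    rw [this]
    simpa using h

theorem mem_span_range_X_iff [Fintype σ] {F : MvPowerSeries σ A} :
    F ∈ span (Set.range X) ↔ constantCoeff F = 0 := by
  simpa using mem_span_C_sup_span_range_X_iff (c := (0 : A)) (F := F)

theorem regSeqMod_X [DecidableEq σ] {c : A} (s : Finset σ) (l : List σ) (hl : l.Nodup)
    (hs : ∀ i ∈ l, i ∉ s) :
    RegSeqMod (span {C c} ⊔ span (X '' (s : Set σ)) : Ideal (MvPowerSeries σ A)) (l.map X) := by
  induction l generalizing s with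
  | nil => trivial
  | cons i l ih =>
    rw [List.nodup_cons] at hl
    simp only [List.mem_cons, forall_eq_or_imp] at hs
    refine ⟨fun F hF ↦ ?_, ?_⟩
    · rw [mem_span_C_sup_span_X_iff] at hF ⊢
      intro e he
      have := hF (Finsupp.single i 1 + e) (by
        intro j hj
        have hij : i ≠ j := by rintro rfl; exact hs.1 hj
        simp [he j hj, hij])
      rwa [X_def, coeff_add_monomial_mul, one_mul] at this
    · have h1 : (span {C c} ⊔ span (X '' (s : Set σ)) ⊔ span {X i} : Ideal (MvPowerSeries σ A)) =
          span {C c} ⊔ span (X '' ((insert i s : Finset σ) : Set σ)) := by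
        rw [sup_assoc, ← span_union, Finset.coe_insert, Set.image_insert_eq, Set.union_singleton]
      rw [h1]
      refine ih _ hl.2 fun j hj ↦ ?_
      rw [Finset.mem_insert, not_or]
      exact ⟨fun h ↦ hl.1 (h ▸ hj), hs.2 j hj⟩

theorem regSeqMod_ofFn_X {n : ℕ} (c : A) :
    RegSeqMod (span {C c} : Ideal (MvPowerSeries (Fin n) A)) (List.ofFn X) := by
  have := regSeqMod_X (c := c) (∅ : Finset (Fin n)) (List.finRange n) (List.nodup_finRange n)
    (by simp)
  simpa [List.ofFn_eq_map] using this

/-- A power series of order at least two is a combination of the variables with coefficients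
that have no constant term. -/
theorem exists_of_mem_span_range_X_sq [Fintype σ] {F : MvPowerSeries σ A}
    (hF : F ∈ (span (Set.range X) : Ideal (MvPowerSeries σ A)) ^ 2) :
    ∃ g : σ → MvPowerSeries σ A, (∀ j, constantCoeff (g j) = 0) ∧ F = ∑ j, g j * X j := by
  rw [pow_two, ← smul_eq_mul] at hF
  obtain ⟨a, ha, rfl⟩ := (Submodule.mem_ideal_smul_span_iff_exists_sum _ _ _).1 hF
  refine ⟨a, fun j ↦ mem_span_range_X_iff.1 (ha j), ?_⟩
  rw [Finsupp.sum_fintype _ _ (by simp)]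
  simp

theorem coeff_single_of_mem_span_range_X_sq [Fintype σ] {F : MvPowerSeries σ A}
    (hF : F ∈ (span (Set.range X) : Ideal (MvPowerSeries σ A)) ^ 2) (i : σ) :
    coeff (Finsupp.single i 1) F = 0 := by
  classical
  obtain ⟨g, hg, rfl⟩ := exists_of_mem_span_range_X_sq hF
  rw [map_sum]
  refine Finset.sum_eq_zero fun j _ ↦ ?_
  by_cases hij : j = i
  · subst hij
    have := coeff_add_mul_monomial (0 : σ →₀ ℕ) (Finsupp.single j 1) (g j) 1
    rw [zero_add, mul_one] at this
    rw [X_def, this]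
    exact hg j
  · rw [X_def, coeff_mul_monomial, if_neg]
    rw [Finsupp.single_le_iff]
    simp [Ne.symm hij]

theorem coeff_single_mul_X [Fintype σ] [DecidableEq σ] (g : MvPowerSeries σ A) (i j : σ) :
    coeff (Finsupp.single i 1) (g * X j) = if i = j then constantCoeff g else 0 := by
  split_ifs with hij
  · subst hij
    have := coeff_add_mul_monomial (0 : σ →₀ ℕ) (Finsupp.single i 1) g 1
    rw [zero_add, mul_one] at this
    rw [X_def, this]
    rfl
  · rw [X_def, coeff_mul_monomial, if_neg]
    rw [Finsupp.single_le_iff]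
    simp [hij]

end Coeff

section Local

variable {n : ℕ} {O : Type*} [CommRing O] [IsLocalRing O]

theorem mem_maximalIdeal_iff {F : MvPowerSeries (Fin n) O} :
    F ∈ maximalIdeal (MvPowerSeries (Fin n) O) ↔ constantCoeff F ∈ maximalIdeal O := by
  rw [mem_maximalIdeal, mem_maximalIdeal, mem_nonunits_iff, mem_nonunits_iff,
    isUnit_iff_constantCoeff]

theorem X_mem_maximalIdeal (i : Fin n) :
    (X i : MvPowerSeries (Fin n) O) ∈ maximalIdeal (MvPowerSeries (Fin n) O) := by
  rw [mem_maximalIdeal_iff, constantCoeff_X]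
  exact zero_mem _

theorem maximalIdeal_eq {ϖ : O} (hϖ : maximalIdeal O = span {ϖ}) :
    maximalIdeal (MvPowerSeries (Fin n) O) = span {C ϖ} ⊔ span (Set.range X) := by
  ext F
  rw [mem_maximalIdeal_iff, mem_span_C_sup_span_range_X_iff, hϖ, mem_span_singleton]

theorem algHom_X_mem_maximalIdeal
    (φ : MvPowerSeries (Fin n) O →ₐ[O] O) (i : Fin n) : φ (X i) ∈ maximalIdeal O := by
  by_contra h
  have h1 : IsUnit (X i - C (φ (X i)) : MvPowerSeries (Fin n) O) := by
    rw [isUnit_iff_constantCoeff]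
    simpa using h
  have h2 := h1.map φ
  have h3 : φ (C (φ (X i))) = φ (X i) := φ.commutes _
  rw [map_sub, h3, sub_self] at h2
  exact not_isUnit_zero h2

variable [IsNoetherianRing O] [IsAdicComplete (maximalIdeal O) O]

/-- Modulo the `X i - c i`, each variable lies in the ideal generated by the maximal ideal of `O`,
so constants surject modulo that ideal. Completeness of `O` and separatedness of the quotient then
make constants surject outright. -/
theorem exists_sub_C_mem_span (c : Fin n → O) (hc : ∀ i, c i ∈ maximalIdeal O)
    (F : MvPowerSeries (Fin n) O) : ∃ o, F - C o ∈ span (Set.range fun i ↦ X i - C (c i)) := by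
  set P : Ideal (MvPowerSeries (Fin n) O) := span (Set.range fun i ↦ X i - C (c i)) with hP
  have hPm : P ≤ maximalIdeal _ := by
    rw [hP, span_le]
    rintro _ ⟨i, rfl⟩
    rw [SetLike.mem_coe, mem_maximalIdeal_iff]
    simpa using hc i
  have : Nontrivial (MvPowerSeries (Fin n) O ⧸ P) :=
    Ideal.Quotient.nontrivial_iff.2 fun h ↦
      (maximalIdeal.isMaximal _).ne_top (top_le_iff.1 (h ▸ hPm))
  have : IsLocalRing (MvPowerSeries (Fin n) O ⧸ P) :=
    .of_surjective' (Ideal.Quotient.mk P) Ideal.Quotient.mk_surjective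
  let ψ : O →+* MvPowerSeries (Fin n) O ⧸ P := (Ideal.Quotient.mk P).comp C
  have hmap : (maximalIdeal O).map ψ ≤ maximalIdeal _ := by
    rw [map_le_iff_le_comap]
    intro a ha
    rw [mem_comap, mem_maximalIdeal, mem_nonunits_iff]
    intro hu
    have : IsLocalHom (Ideal.Quotient.mk P) := .of_surjective _ Ideal.Quotient.mk_surjective
    have hu' := (isUnit_map_iff (Ideal.Quotient.mk P) (C a)).1 hu
    rw [isUnit_iff_constantCoeff] at hu'
    exact ha (by simpa using hu')
  have : IsHausdorff ((maximalIdeal O).map ψ) (MvPowerSeries (Fin n) O ⧸ P) :=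
    .of_le_jacobson _ _ (hmap.trans (maximalIdeal_le_jacobson _))
  have hsurj : Function.Surjective ψ := by
    refine surjective_of_mk_map_comp_surjective (I := maximalIdeal O) ψ fun q ↦ ?_
    obtain ⟨q, rfl⟩ := Ideal.Quotient.mk_surjective q
    obtain ⟨G, rfl⟩ := Ideal.Quotient.mk_surjective q
    refine ⟨constantCoeff G, ?_⟩
    rw [RingHom.comp_apply, eq_comm, Ideal.Quotient.eq]
    have hG : G - C (constantCoeff G) ∈ span (Set.range X) := by
      rw [mem_span_range_X_iff]; simp
    obtain ⟨g, hg⟩ := mem_span_range_iff_exists_fun.1 hG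
    change Ideal.Quotient.mk P G - Ideal.Quotient.mk P (C (constantCoeff G)) ∈ _
    rw [← map_sub, ← hg, map_sum]
    refine _root_.sum_mem fun i _ ↦ ?_
    rw [map_mul]
    refine mul_mem_left _ _ ?_
    have : Ideal.Quotient.mk P (X i) = ψ (c i) := by
      change _ = Ideal.Quotient.mk P (C (c i))
      rw [Ideal.Quotient.eq]
      exact subset_span ⟨i, rfl⟩
    rw [this]
    exact mem_map_of_mem _ (hc i)
  obtain ⟨o, ho⟩ := hsurj (Ideal.Quotient.mk P F)
  refine ⟨o, ?_⟩
  rw [← Ideal.Quotient.eq]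
  exact ho.symm

theorem ker_algHom (φ : MvPowerSeries (Fin n) O →ₐ[O] O) :
    RingHom.ker φ = span (Set.range fun i ↦ X i - C (φ (X i))) := by
  have hC : ∀ o, φ (C o) = o := fun o ↦ φ.commutes o
  have hle : span (Set.range fun i ↦ X i - C (φ (X i))) ≤ RingHom.ker φ := by
    rw [span_le]
    rintro _ ⟨i, rfl⟩
    simp [RingHom.mem_ker, hC]
  refine le_antisymm (fun F hF ↦ ?_) hle
  obtain ⟨o, ho⟩ := exists_sub_C_mem_span (fun i ↦ φ (X i))
    (algHom_X_mem_maximalIdeal φ) F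
  have h1 := hle ho
  rw [RingHom.mem_ker, map_sub, hC, (RingHom.mem_ker).1 hF, zero_sub, neg_eq_zero] at h1
  simpa [h1] using ho

theorem algHom_eq_constantCoeff (φ : MvPowerSeries (Fin n) O →ₐ[O] O) (h : ∀ i, φ (X i) = 0)
    (F : MvPowerSeries (Fin n) O) : φ F = constantCoeff F := by
  have hF : F - C (constantCoeff F) ∈ RingHom.ker φ := by
    rw [ker_algHom]
    simp only [h, map_zero, sub_zero]
    rw [mem_span_range_X_iff]
    simp
  rw [RingHom.mem_ker, map_sub, sub_eq_zero] at hF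
  rw [hF]
  exact φ.commutes _

end Local

section Evaluation

variable {n : ℕ} {O R : Type*} [CommRing O] [CommRing R] [Algebra O R] {I : Ideal R}
  [IsAdicComplete I R]

/-- Power series can be evaluated at elements of an ideal of definition. -/
theorem exists_algHom_X_eq (x : Fin n → R) (hx : ∀ i, x i ∈ I) :
    ∃ Θ : MvPowerSeries (Fin n) O →ₐ[O] R, ∀ i, Θ (X i) = x i := by
  have hle : ∀ k, MvPolynomial.idealOfVars (Fin n) O ^ k ≤
      (I ^ k).comap (MvPolynomial.aeval (R := O) x) := by
    intro k
    refine (pow_right_mono ?_ k).trans (le_comap_pow _ k)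
    rw [MvPolynomial.idealOfVars, span_le]
    rintro _ ⟨i, rfl⟩
    simpa using hx i
  let f : (k : ℕ) → MvPowerSeries (Fin n) O →ₐ[O] R ⧸ I ^ k := fun k ↦
    (quotientMapₐ (I ^ k) (MvPolynomial.aeval (R := O) x) (hle k)).comp
      ((truncTotalAlgHom (Fin n) O k).restrictScalars O)
  have hf : ∀ k F, f k F = Ideal.Quotient.mk (I ^ k) (MvPolynomial.aeval x (truncTotal k F)) :=
    fun k F ↦ rfl
  let Θ := IsAdicComplete.liftAlgHom I f (fun {k l} hkl ↦ by
    refine AlgHom.ext fun F ↦ ?_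
    change Ideal.Quotient.factor (pow_le_pow_right hkl) (f l F) = f k F
    rw [hf, hf, Ideal.Quotient.factor_mk, Ideal.Quotient.eq, ← map_sub]
    exact hle k (truncTotal_sub_truncTotal_mem_pow_idealOfVars hkl le_rfl F))
  refine ⟨Θ, fun i ↦ ?_⟩
  refine (IsHausdorff.eq_iff_smodEq (I := I)).2 fun k ↦ ?_
  rw [smul_eq_mul, mul_top, SModEq]
  have h1 : Ideal.Quotient.mk (I ^ k) (Θ (X i)) = f k (X i) := IsAdicComplete.mk_liftAlgHom _ _ _ _ _
  refine h1.trans ?_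
  rw [hf]
  have h2 : Ideal.Quotient.mk (MvPolynomial.idealOfVars (Fin n) O ^ k) (truncTotal k (X i)) =
      Ideal.Quotient.mk _ (MvPolynomial.X i) := by
    have := (truncTotalAlgHom (Fin n) O k).commutes (MvPolynomial.X i)
    have hX : algebraMap (MvPolynomial (Fin n) O) (MvPowerSeries (Fin n) O) (MvPolynomial.X i) =
        X i := MvPolynomial.coe_X i
    rw [hX] at this
    exact this
  rw [Ideal.Quotient.eq] at h2
  have h3 := hle k h2
  rw [mem_comap, map_sub, MvPolynomial.aeval_X, ← Ideal.Quotient.eq] at h3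
  exact h3

/-- Since `R = O + ker ρ`, constants already surject modulo the ideal generated by the variables;
adic completeness of the power series ring does the rest. -/
theorem surjective_algHom_of_ker_eq [IsNoetherianRing R] [IsLocalRing R] (ρ : R →ₐ[O] O)
    [Nontrivial O] (Θ : MvPowerSeries (Fin n) O →ₐ[O] R)
    (h : RingHom.ker ρ = span (Set.range fun i ↦ Θ (X i))) : Function.Surjective Θ := by
  have hmap : (span (Set.range X) : Ideal (MvPowerSeries (Fin n) O)).map (Θ : MvPowerSeries (Fin n) O →+* R) =
      RingHom.ker ρ := by
    rw [map_span, ← Set.range_comp, h]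
    rfl
  have hne : RingHom.ker ρ ≠ ⊤ := RingHom.ker_ne_top ρ
  have : IsHausdorff ((span (Set.range X) : Ideal (MvPowerSeries (Fin n) O)).map (Θ : MvPowerSeries (Fin n) O →+* R)) R :=
    .of_isLocalRing _ _ (by rwa [hmap])
  refine surjective_of_mk_map_comp_surjective (I := span (Set.range X)) (Θ : MvPowerSeries (Fin n) O →+* R) fun q ↦ ?_
  obtain ⟨r, rfl⟩ := Ideal.Quotient.mk_surjective q
  refine ⟨C (ρ r), ?_⟩
  rw [RingHom.comp_apply, Ideal.Quotient.eq, hmap, RingHom.mem_ker, map_sub]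
  have h1 : (Θ : MvPowerSeries (Fin n) O →+* R) (C (ρ r)) = algebraMap O R (ρ r) := Θ.commutes _
  rw [h1, ρ.commutes, sub_eq_zero]
  rfl

end Evaluation

end MvPowerSeries

end

section

/-! ### Lengths over a principal ideal domain via Smith normal form. -/

section Length

open Module

variable {O : Type*} [CommRing O] [IsDomain O]

theorem Ring.ord_prod {ι : Type*} (s : Finset ι) (a : ι → O) (ha : ∀ i ∈ s, a i ≠ 0) :
    Ring.ord O (∏ i ∈ s, a i) = ∑ i ∈ s, Ring.ord O (a i) := by
  classical
  induction s using Finset.induction_on with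
  | empty => simp
  | insert i s hi ih =>
    simp only [Finset.mem_insert, forall_eq_or_imp] at ha
    rw [Finset.prod_insert hi, Finset.sum_insert hi, ← ih ha.2,
      Ring.ord_mul' _ (mem_nonZeroDivisors_of_ne_zero ha.1)]

variable [IsPrincipalIdealRing O]

/-- A module with `n` generators that satisfy the relations given by the rows of an `n × n` matrix
has length at most the order of the determinant of the matrix. -/
theorem Module.length_le_ord_det {n : ℕ} {Φ : Type*} [AddCommGroup Φ] [Module O Φ]
    (g : (Fin n → O) →ₗ[O] Φ) (hg : Function.Surjective g) (A : Matrix (Fin n) (Fin n) O)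
    (hA : A.det ≠ 0) (hgA : ∀ i, g (A i) = 0) : Module.length O Φ ≤ Ring.ord O A.det := by
  let N : Submodule O (Fin n → O) := Submodule.span O (Set.range A)
  have hli : LinearIndependent O A := Matrix.linearIndependent_rows_of_det_ne_zero hA
  have hN : finrank O N = finrank O (Fin n → O) := by
    rw [finrank_span_eq_card hli]; simp
  let b := Pi.basisFun O (Fin n)
  let c := Submodule.smithNormalFormCoeffs b hN
  let b' := Submodule.smithNormalFormTopBasis b hN
  let ab := Submodule.smithNormalFormBotBasis b hN
  have hab : ∀ i, (ab i : Fin n → O) = c i • b' i := Submodule.smithNormalFormBotBasis_def b hN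
  have hc : ∀ i, c i ≠ 0 := Submodule.smithNormalFormCoeffs_ne_zero b hN
  -- The invariant factors `c` describe the row lattice `N`, so `A` factors through `diagonal c`.
  have hdvd : ∏ i, c i ∣ A.det := by
    have hmem : ∀ i, A i ∈ N := fun i ↦ Submodule.subset_span ⟨i, rfl⟩
    choose p hp using fun i ↦ (ab.mem_submodule_iff').1 (hmem i)
    have : A = Matrix.of p * Matrix.diagonal c * Matrix.of (fun j k ↦ b' j k) := by
      ext i k
      rw [hp i, Matrix.mul_apply, Finset.sum_apply]
      refine Finset.sum_congr rfl fun j _ ↦ ?_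
      rw [hab, Matrix.mul_diagonal]
      simp [mul_assoc]
    rw [this, Matrix.det_mul, Matrix.det_mul, Matrix.det_diagonal]
    exact Dvd.dvd.mul_right (Dvd.intro_left _ rfl) _
  have hker : N ≤ LinearMap.ker g := by
    rw [Submodule.span_le]
    rintro _ ⟨i, rfl⟩
    exact hgA i
  have hlen : Module.length O ((Fin n → O) ⧸ N) = Ring.ord O (∏ i, c i) := by
    rw [(Submodule.quotientEquivPiSpan N b hN).length_eq, Module.length_pi_of_fintype,
      Ring.ord_prod _ _ fun i _ ↦ hc i]
    rfl
  calc Module.length O Φ ≤ Module.length O ((Fin n → O) ⧸ N) :=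
        Module.length_le_of_surjective (N.liftQ g hker) (by
          intro x
          obtain ⟨y, rfl⟩ := hg x
          exact ⟨Submodule.Quotient.mk y, rfl⟩)
    _ = Ring.ord O (∏ i, c i) := hlen
    _ ≤ Ring.ord O A.det := Ring.ord_le_ord_of_dvd hdvd

/-- A module of finite length over a principal ideal domain that is not a field has a generating
family annihilated by elements whose product has order the length of the module. -/
theorem Module.exists_generators_of_length_ne_top (hO : ¬ IsField O) {Φ : Type*} [AddCommGroup Φ]
    [Module O Φ] (h : Module.length O Φ ≠ ⊤) :
    ∃ (n : ℕ) (g : Fin n → Φ) (a : Fin n → O), Submodule.span O (Set.range g) = ⊤ ∧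
      (∀ i, a i ≠ 0) ∧ (∀ i, a i • g i = 0) ∧ Ring.ord O (∏ i, a i) = Module.length O Φ := by
  classical
  rw [Module.length_ne_top_iff, isFiniteLength_iff_isNoetherian_isArtinian] at h
  obtain ⟨_, _⟩ := h
  -- A torsion-free element would embed `O` in an Artinian module, which forces `O` to be a field.
  have htors : Module.IsTorsion O Φ := by
    intro x
    by_contra! hx
    have hinj : Function.Injective (LinearMap.toSpanSingleton O Φ x) := by
      rw [← LinearMap.ker_eq_bot, LinearMap.ker_eq_bot']
      intro r hr
      by_contra hr0
      exact hx ⟨r, mem_nonZeroDivisors_of_ne_zero hr0⟩ hr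
    have : IsArtinianRing O := isArtinian_of_injective _ hinj
    exact hO (IsArtinianRing.isField_of_isDomain O)
  obtain ⟨ι, _, p, hp, e, ⟨E⟩⟩ := Module.equiv_directSum_of_isTorsion htors
  let E' : Φ ≃ₗ[O] (∀ i, O ⧸ Submodule.span O {p i ^ e i}) :=
    E.trans (DirectSum.linearEquivFunOnFintype O ι _)
  let σ := (Fintype.equivFin ι).symm
  let w : ι → ∀ i, O ⧸ Submodule.span O {p i ^ e i} :=
    fun i ↦ Pi.single i (Submodule.Quotient.mk 1)
  let v : ι → Φ := fun i ↦ E'.symm (w i)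
  refine ⟨_, v ∘ σ, fun i ↦ p (σ i) ^ e (σ i), ?_, fun i ↦ pow_ne_zero _ (hp _).ne_zero, fun i ↦ ?_,
    ?_⟩
  · rw [σ.surjective.range_comp, eq_top_iff]
    intro x _
    obtain ⟨y, rfl⟩ := E'.symm.surjective x
    choose r hr using fun i ↦ Submodule.Quotient.mk_surjective _ (y i)
    have hy : y = ∑ i, r i • w i := by
      funext i
      rw [Finset.sum_apply, Finset.sum_eq_single i]
      · rw [Pi.smul_apply, show w i i = Submodule.Quotient.mk 1 from Pi.single_eq_same _ _, ← Submodule.Quotient.mk_smul, smul_eq_mul, mul_one, hr]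
      · intro j _ hj
        rw [Pi.smul_apply, show w j i = 0 from Pi.single_eq_of_ne hj.symm _, smul_zero]
      · simp
    rw [hy, map_sum]
    refine sum_mem fun i _ ↦ ?_
    rw [map_smul]
    exact Submodule.smul_mem _ _ (Submodule.subset_span ⟨i, rfl⟩)
  · change _ • E'.symm (Pi.single _ _) = 0
    rw [← map_smul, ← Pi.single_smul, ← Submodule.Quotient.mk_smul, smul_eq_mul, mul_one,
      (Submodule.Quotient.mk_eq_zero _).2 (Submodule.mem_span_singleton_self _), Pi.single_zero,
      map_zero]
  · rw [σ.prod_comp (fun i ↦ p i ^ e i), Ring.ord_prod _ _ fun i _ ↦ pow_ne_zero _ (hp i).ne_zero,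
      E'.length_eq, Module.length_pi_of_fintype]
    rfl

end Length

end

/-! ### Augmented finite algebras and the annihilator of the augmentation ideal. -/

section

open IsLocalRing

theorem det_mul_mem_span_range {B : Type*} [CommRing B] {n : ℕ} {A : Matrix (Fin n) (Fin n) B}
    {y r : Fin n → B} (hA : ∀ i, ∑ j, A i j * y j = r i) (j : Fin n) :
    A.det * y j ∈ Ideal.span (Set.range r) := by
  have h1 : A.adjugate.mulVec (A.mulVec y) j = A.det * y j := by
    rw [Matrix.mulVec_mulVec, Matrix.adjugate_mul, Matrix.smul_mulVec, Matrix.one_mulVec]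
    simp
  have h2 : A.mulVec y = r := funext hA
  rw [← h1, h2]
  change ∑ i, A.adjugate j i * r i ∈ Ideal.span (Set.range r)
  exact sum_mem fun i _ ↦ Ideal.mul_mem_left _ _ (Ideal.subset_span (Set.mem_range_self i))

section FiniteAlgebra

variable {O T : Type*} [CommRing O] [CommRing T] [Algebra O T]

/-- By integrality, every prime of `T` containing `ϖ` lies over the maximal ideal of `O`, hence is
maximal. -/
theorem exists_maximalIdeal_pow_le [IsLocalRing O] [IsLocalRing T] [IsNoetherianRing T]
    [Algebra.IsIntegral O T] {ϖ : O} (hϖ : maximalIdeal O = Ideal.span {ϖ}) :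
    ∃ N, maximalIdeal T ^ N ≤ Ideal.span {algebraMap O T ϖ} := by
  refine Ideal.exists_pow_le_of_le_radical_of_fg_radical ?_ (IsNoetherian.noetherian _)
  rw [Ideal.radical_eq_sInf]
  refine le_sInf fun q ⟨hq, hqp⟩ ↦ ?_
  have hle : maximalIdeal O ≤ q.comap (algebraMap O T) := by
    rw [hϖ, Ideal.span_singleton_le_iff_mem, Ideal.mem_comap, ← Ideal.span_singleton_le_iff_mem]
    exact hq
  have heq : maximalIdeal O = q.comap (algebraMap O T) :=
    (maximalIdeal.isMaximal O).eq_of_le (Ideal.comap_ne_top _ hqp.ne_top) hle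
  have : (q.comap (algebraMap O T)).IsMaximal := heq ▸ maximalIdeal.isMaximal O
  have := Ideal.isMaximal_of_isIntegral_of_isMaximal_comap (R := O) q this
  rw [IsLocalRing.eq_maximalIdeal this]

theorem AlgHom.smul_eq_of_mul_ker_eq_zero (f : T →ₐ[O] O) {s : T}
    (hs : ∀ t ∈ RingHom.ker f, t * s = 0) (t : T) : t * s = f t • s := by
  have h := hs (t - algebraMap O T (f t)) (by
    rw [RingHom.mem_ker, map_sub, f.commutes, sub_eq_zero]; rfl)
  rw [sub_mul, sub_eq_zero] at h
  rw [h, Algebra.smul_def]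

/-- By incomparability `ker f` is a minimal prime, hence the annihilator of some `z`. If `f z = 0`
then `z ^ 2 = 0`, against reducedness. Thus the augmentation splits off generically. -/
theorem exists_annihilator_ker [IsDomain O] [IsNoetherianRing T] [IsReduced T]
    [Algebra.IsIntegral O T] (f : T →ₐ[O] O) :
    ∃ z, (∀ t ∈ RingHom.ker f, t * z = 0) ∧ f z ≠ 0 := by
  have hprime : (RingHom.ker f).IsPrime := RingHom.ker_isPrime f
  obtain ⟨q, hq, hqp⟩ := Ideal.exists_minimalPrimes_le (I := (⊥ : Ideal T)) (J := RingHom.ker f)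
    bot_le
  have hqprime : q.IsPrime := hq.1.1
  have hass : IsAssociatedPrime q T := by
    apply Module.associatedPrimes.minimalPrimes_annihilator_subset_associatedPrimes T T
    rwa [Module.annihilator_eq_bot.2 inferInstance]
  obtain ⟨z, hz⟩ := (Submodule.isAssociatedPrime_iff.1 hass).2
  have hple : RingHom.ker f ≤ q := by
    intro x hx
    by_contra hxq
    have hlt := Ideal.comap_lt_comap_of_integral_mem_sdiff (R := O) hqp ⟨hx, hxq⟩
      (Algebra.IsIntegral.isIntegral x)
    have hbot : (RingHom.ker f).comap (algebraMap O T) = ⊥ := by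
      rw [eq_bot_iff]
      intro o ho
      rw [Ideal.mem_comap, RingHom.mem_ker, f.commutes] at ho
      exact ho
    rw [hbot] at hlt
    exact not_lt_bot hlt
  have hann : ∀ t, t ∈ q ↔ t * z = 0 := by
    intro t
    rw [hz, Submodule.mem_colon_singleton]
    simp
  refine ⟨z, fun t ht ↦ (hann t).1 (hple ht), fun h0 ↦ ?_⟩
  have h1 : z * z = 0 := (hann z).1 (hple h0)
  have h2 : z = 0 := by
    have : IsNilpotent z := ⟨2, by rw [pow_two, h1]⟩
    exact this.eq_zero
  apply hqprime.ne_top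
  rw [Ideal.eq_top_iff_one, hann, h2, mul_zero]

theorem Ideal.Cotangent.smul_eq_algHom_smul (f : T →ₐ[O] O) (t : T)
    (c : (RingHom.ker f).Cotangent) : t • c = f t • c := by
  have h := Ideal.Cotangent.smul_eq_zero_of_mem (I := RingHom.ker f)
    (x := t - algebraMap O T (f t)) (by
      rw [RingHom.mem_ker, map_sub, f.commutes, sub_eq_zero]; rfl) c
  rw [sub_smul, sub_eq_zero, algebraMap_smul] at h
  exact h

/-- The cotangent space at an augmentation whose kernel has `n` generators with relations given
by the rows of a square matrix has length at most the order of the determinant. -/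
theorem length_cotangent_le_ord_det [IsDomain O] [IsPrincipalIdealRing O] (f : T →ₐ[O] O) {n : ℕ}
    (x : Fin n → T) (hx : RingHom.ker f = Ideal.span (Set.range x))
    (A : Matrix (Fin n) (Fin n) T) (hA : f A.det ≠ 0) (hAx : ∀ i, ∑ j, A i j * x j = 0) :
    Module.length O (RingHom.ker f).Cotangent ≤ Ring.ord O (f A.det) := by
  have hxm : ∀ j, x j ∈ RingHom.ker f := fun j ↦ hx ▸ Ideal.subset_span ⟨j, rfl⟩
  let v : Fin n → (RingHom.ker f).Cotangent := fun j ↦ (RingHom.ker f).toCotangent ⟨x j, hxm j⟩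
  have hv : ∀ c : Fin n → T, ∀ h : ∑ j, c j * x j ∈ RingHom.ker f,
      (RingHom.ker f).toCotangent ⟨∑ j, c j * x j, h⟩ = ∑ j, f (c j) • v j := by
    intro c h
    have : (⟨∑ j, c j * x j, h⟩ : RingHom.ker f) = ∑ j, c j • ⟨x j, hxm j⟩ := by
      ext; simp
    rw [this, map_sum]
    refine Finset.sum_congr rfl fun j _ ↦ ?_
    rw [map_smul, Ideal.Cotangent.smul_eq_algHom_smul]
  have hdet : f A.det = (A.map f).det := by
    exact RingHom.map_det (f : T →+* O) A
  rw [hdet] at hA ⊢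
  refine Module.length_le_ord_det (Fintype.linearCombination O v) ?_ _ hA fun i ↦ ?_
  · intro c
    obtain ⟨⟨y, hy⟩, rfl⟩ := Ideal.toCotangent_surjective _ c
    obtain ⟨t, ht⟩ := Ideal.mem_span_range_iff_exists_fun.1 (hx ▸ hy)
    subst ht
    exact ⟨fun j ↦ f (t j), by rw [hv, Fintype.linearCombination_apply]⟩
  · have h0 : ∑ j, A i j * x j ∈ RingHom.ker f := by rw [hAx]; exact zero_mem _
    rw [Fintype.linearCombination_apply]
    refine (hv (A i) h0).symm.trans ?_
    rw [Ideal.toCotangent_eq_zero]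
    simp [hAx]

end FiniteAlgebra

section CompleteIntersection

variable {O T : Type*} [CommRing O] [IsDomain O] [IsDiscreteValuationRing O]

open MvPowerSeries Ideal

theorem exists_ofFn_eq {α : Type*} {n : ℕ} (l : List α) (h : l.length = n) :
    ∃ r : Fin n → α, List.ofFn r = l := by
  subst h
  exact ⟨l.get, List.ofFn_get l⟩

theorem regSeqMod_C_cons_X_pow {n N : ℕ} (hN : N ≠ 0) {ϖ : O} (hϖ : ϖ ≠ 0) :
    RegSeqMod (⊥ : Ideal (MvPowerSeries (Fin n) O)) (C ϖ :: (List.ofFn X).map (· ^ N)) := by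
  refine ⟨fun b hb ↦ ?_, ?_⟩
  · rw [mem_bot, mul_eq_zero] at hb
    rcases hb with hb | hb
    · exact absurd (by simpa using congrArg constantCoeff hb) hϖ
    · exact hb
  · rw [bot_sup_eq]
    refine (regSeqMod_ofFn_X ϖ).pow (fun x hx ↦ ?_) hN
    obtain ⟨i, rfl⟩ := (List.mem_ofFn' _ _).1 hx
    exact X_mem_maximalIdeal i

/-- For an augmented reduced complete intersection that is finite over a complete discrete
valuation ring, the annihilator of the augmentation ideal is generated by an element whose image
under the augmentation has order at least the length of the cotangent space. -/
theorem IsCompleteIntersection.exists_generator_annihilator_ker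
    [IsAdicComplete (maximalIdeal O) O] [CommRing T] [Algebra O T] [IsLocalRing T] [Module.Finite O T]
    [IsReduced T] (hT : IsCompleteIntersection O T) (f : T →ₐ[O] O) :
    ∃ δ : T, (∀ t ∈ RingHom.ker f, t * δ = 0) ∧
      (∀ s, (∀ t ∈ RingHom.ker f, t * s = 0) → ∃ r : O, s = r • δ) ∧ f δ ≠ 0 ∧
      Module.length O (RingHom.ker f).Cotangent ≤ Ring.ord O (f δ) := by
  obtain ⟨n, rs, hrs, ⟨E⟩⟩ := hT
  obtain ⟨ϖ, hϖ⟩ := IsDiscreteValuationRing.exists_irreducible O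
  have hϖm := hϖ.maximalIdeal_eq
  have : IsNoetherianRing T := IsNoetherianRing.of_finite O T
  let ψ : MvPowerSeries (Fin n) O →ₐ[O] T := E.toAlgHom.comp (Ideal.Quotient.mkₐ O (ofList rs))
  have hψ : Function.Surjective ψ := E.surjective.comp Ideal.Quotient.mk_surjective
  have hψker : ∀ b, ψ b = 0 ↔ b ∈ ofList rs := by
    intro b
    change E (Ideal.Quotient.mk _ b) = 0 ↔ _
    rw [EmbeddingLike.map_eq_zero_iff, Ideal.Quotient.eq_zero_iff_mem]
  have hreg := isWeaklyRegular_iff_regSeqMod.1 hrs.toIsWeaklyRegular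
  let φ : MvPowerSeries (Fin n) O →ₐ[O] O := f.comp ψ
  let y : Fin n → MvPowerSeries (Fin n) O := fun i ↦ X i - C (φ (X i))
  have hφ : RingHom.ker φ = span (Set.range y) := ker_algHom φ
  have hym : ∀ i, y i ∈ maximalIdeal (MvPowerSeries (Fin n) O) := by
    intro i
    rw [mem_maximalIdeal_iff]
    simpa [y] using algHom_X_mem_maximalIdeal φ i
  have hrsφ : ofList rs ≤ span (Set.range y) := by
    rw [← hφ]
    intro b hb
    change f (ψ b) = 0
    rw [(hψker b).2 hb, map_zero]
  have hyle : span (Set.range y) ≤ maximalIdeal (MvPowerSeries (Fin n) O) := by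
    rw [span_le]; rintro _ ⟨i, rfl⟩; exact hym i
  have hrsm : ∀ r ∈ rs, r ∈ maximalIdeal (MvPowerSeries (Fin n) O) := fun r hr ↦
    hyle (hrsφ (subset_span hr))
  -- At most `n`, because `rs` lies in the ideal of the `n` elements `y`. At least `n`, because
  -- finiteness of `T` puts `ϖ` and powers of the variables, a regular sequence of length `n + 1`,
  -- inside `(ϖ, rs)`.
  have hlen : rs.length = n := by
    refine le_antisymm ?_ ?_
    · simpa using hreg.length_le (ys := List.ofFn y) bot_le
        (fun x hx ↦ by obtain ⟨i, rfl⟩ := (List.mem_ofFn' _ _).1 hx; exact hym i)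
        (fun r hr ↦ by rw [bot_sup_eq, ofList_ofFn]; exact hrsφ (subset_span hr))
    · obtain ⟨N, hN⟩ := exists_maximalIdeal_pow_le (T := T) hϖm
      have h1 := (regSeqMod_C_cons_X_pow (n := n) N.succ_ne_zero hϖ.ne_zero).length_le
        (ys := C ϖ :: rs) bot_le (by
          rw [List.forall_mem_cons]
          refine ⟨?_, hrsm⟩
          rw [mem_maximalIdeal_iff, constantCoeff_C, hϖm]
          exact mem_span_singleton_self _) (by
          rw [bot_sup_eq, ofList_cons, List.forall_mem_cons]
          refine ⟨mem_sup_left (mem_span_singleton_self _), fun x hx ↦ ?_⟩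
          obtain ⟨_, hx', rfl⟩ := List.mem_map.1 hx
          obtain ⟨i, rfl⟩ := (List.mem_ofFn' _ _).1 hx'
          have hXi : ψ (X i) ∈ maximalIdeal T := by
            intro hu
            exact algHom_X_mem_maximalIdeal φ i (hu.map f)
          have h2 : ψ (X i) ^ N.succ ∈ span {algebraMap O T ϖ} :=
            hN (pow_le_pow_right N.le_succ (pow_mem_pow hXi _))
          obtain ⟨t, ht⟩ := mem_span_singleton'.1 h2
          obtain ⟨b, rfl⟩ := hψ t
          have h3 : X i ^ N.succ - b * C ϖ ∈ ofList rs := by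
            rw [← hψker, map_sub, map_pow, map_mul, ← ht, sub_eq_zero]
            congr 1
            exact (ψ.commutes ϖ).symm
          rw [sup_comm]
          exact mem_sup_span_singleton_iff.2 ⟨b, h3⟩)
      simpa using h1
  obtain ⟨r, rfl⟩ := exists_ofFn_eq rs hlen
  rw [ofList_ofFn] at hψker hrsφ
  obtain ⟨A, hA⟩ : ∃ A : Matrix (Fin n) (Fin n) (MvPowerSeries (Fin n) O),
      ∀ i, ∑ j, A i j * y j = r i := by
    choose A hA using fun i ↦ mem_span_range_iff_exists_fun.1 (hrsφ (subset_span ⟨i, rfl⟩))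
    exact ⟨Matrix.of A, hA⟩
  have hdet := det_mul_mem_span_range hA
  have hker : RingHom.ker f = span (Set.range fun i ↦ ψ (y i)) := by
    apply le_antisymm
    · intro t ht
      obtain ⟨b, rfl⟩ := hψ t
      have hb : b ∈ span (Set.range y) := hφ ▸ ht
      have := mem_map_of_mem (ψ : _ →+* T) hb
      rw [map_span, ← Set.range_comp] at this
      exact this
    · rw [span_le]
      rintro _ ⟨i, rfl⟩
      have : y i ∈ RingHom.ker φ := hφ ▸ subset_span ⟨i, rfl⟩
      exact this
  have hδ : ∀ t ∈ RingHom.ker f, t * ψ (Matrix.det A) = 0 := by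
    intro t ht
    rw [hker] at ht
    obtain ⟨c, rfl⟩ := mem_span_range_iff_exists_fun.1 ht
    rw [Finset.sum_mul]
    refine Finset.sum_eq_zero fun j _ ↦ ?_
    rw [mul_assoc, ← map_mul, mul_comm (y j), (hψker _).2 (hdet j), mul_zero]
  have hgen : ∀ s, (∀ t ∈ RingHom.ker f, t * s = 0) → ∃ o : O, s = o • ψ (Matrix.det A) := by
    intro s hs
    obtain ⟨b, rfl⟩ := hψ s
    have h7 := RegSeqMod.mem_sup_span_det (f := r) (y := y) (t := b) bot_le
      (fun i ↦ hrsm _ ((List.mem_ofFn' _ _).2 ⟨i, rfl⟩)) hym hreg A (fun i ↦ by simp [hA i])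
      (fun j ↦ by
        rw [bot_sup_eq, ← hψker, map_mul, mul_comm]
        exact hs _ (hker ▸ subset_span ⟨j, rfl⟩))
    rw [bot_sup_eq] at h7
    obtain ⟨g, hg⟩ := mem_sup_span_singleton_iff.1 h7
    rw [← hψker, map_sub, sub_eq_zero, map_mul] at hg
    exact ⟨f (ψ g), by rw [hg, f.smul_eq_of_mul_ker_eq_zero hδ]⟩
  -- Reducedness provides an annihilating element with nonzero augmentation, and it is a multiple of
  -- this determinant.
  have hne : f (ψ (Matrix.det A)) ≠ 0 := by
    obtain ⟨z, hz, hfz⟩ := exists_annihilator_ker f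
    obtain ⟨o, rfl⟩ := hgen z hz
    intro h0
    rw [map_smul, h0, smul_zero] at hfz
    exact hfz rfl
  refine ⟨ψ (Matrix.det A), hδ, hgen, hne, ?_⟩
  have hdet' : ψ (Matrix.det A) = (Matrix.map A ψ).det := by
    exact RingHom.map_det (ψ : _ →+* T) A
  rw [hdet'] at hne ⊢
  refine length_cotangent_le_ord_det f _ hker _ hne fun i ↦ ?_
  have : ∑ j, ψ (A i j) * ψ (y j) = ψ (r i) := by rw [← hA i, map_sum]; simp
  exact this.trans ((hψker _).2 (subset_span ⟨i, rfl⟩))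

end CompleteIntersection

end

section

open IsLocalRing

/-! ### Generically free modules and their rank. -/

section GenericallyFree

theorem isLocalizedModule_mk_one {O T E M : Type*} [CommRing O] [CommRing T] [Algebra O T]
    [Field E] [Algebra O E] [IsFractionRing O E] [AddCommGroup M] [Module T M] :
    IsLocalizedModule (Algebra.algebraMapSubmonoid T (nonZeroDivisors O))
      (TensorProduct.mk T (T ⊗[O] E) M 1) :=
  (isLocalizedModule_iff_isBaseChange _ (T ⊗[O] E) _).2 (TensorProduct.isBaseChange _ _ _)

variable {O T E M : Type*} [CommRing O] [IsDomain O] [CommRing T] [Algebra O T] [Field E]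
  [Algebra O E] [IsFractionRing O E] [AddCommGroup M] [Module T M] [Module O M]
  [IsScalarTower O T M]

theorem eq_zero_of_one_tmul_eq_zero [Module.IsTorsionFree O M] {y : M}
    (hy : (1 : T ⊗[O] E) ⊗ₜ[T] y = 0) : y = 0 := by
  have := isLocalizedModule_mk_one (O := O) (T := T) (E := E) (M := M)
  obtain ⟨⟨_, o, ho, rfl⟩, hs⟩ := (IsLocalizedModule.eq_zero_iff
    (Algebra.algebraMapSubmonoid T (nonZeroDivisors O)) (TensorProduct.mk T (T ⊗[O] E) M 1)).1 hy
  replace hs : algebraMap O T o • y = 0 := hs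
  rw [algebraMap_smul] at hs
  exact (smul_eq_zero.1 hs).resolve_left (nonZeroDivisors.ne_zero ho)

/-- A linearly independent family in a generically free module whose cardinality is the generic
rank spans a submodule with torsion cokernel. -/
theorem LinearIndependent.exists_smul_mem_span [Module.Finite O T] [Module.Finite T M]
    [Module.IsTorsionFree O M] [Module.Free (T ⊗[O] E) ((T ⊗[O] E) ⊗[T] M)]
    [Nontrivial (T ⊗[O] E)] {d : ℕ}
    (hd : Module.finrank (T ⊗[O] E) ((T ⊗[O] E) ⊗[T] M) = d) {m : Fin d → M}
    (hm : LinearIndependent T m) (y : M) :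
    ∃ o : O, o ≠ 0 ∧ o • y ∈ Submodule.span T (Set.range m) := by
  have hloc := isLocalizedModule_mk_one (O := O) (T := T) (E := E) (M := M)
  have : IsArtinianRing (E ⊗[O] T) := IsArtinianRing.of_finite E _
  have : IsArtinianRing (T ⊗[O] E) :=
    (Algebra.TensorProduct.comm O E T).surjective.isArtinianRing
  have hli := hm.of_isLocalizedModule (T ⊗[O] E)
    (Algebra.algebraMapSubmonoid T (nonZeroDivisors O)) (TensorProduct.mk T (T ⊗[O] E) M 1)
  let b := Module.finBasisOfFinrankEq (T ⊗[O] E) ((T ⊗[O] E) ⊗[T] M) hd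
  let g : (Fin d → T ⊗[O] E) →ₗ[T ⊗[O] E] ((T ⊗[O] E) ⊗[T] M) :=
    Fintype.linearCombination (T ⊗[O] E) (TensorProduct.mk T (T ⊗[O] E) M 1 ∘ m)
  have hg : Function.Injective g := by
    rw [← LinearMap.ker_eq_bot, LinearMap.ker_eq_bot']
    intro c hc
    exact funext (Fintype.linearIndependent_iff.1 hli c hc)
  -- After inverting `O`, the family gives an injection between free modules of equal rank over an
  -- Artinian ring, hence a surjection.
  have hsurj := IsArtinian.surjective_of_injective_endomorphism
    (b.equivFun.toLinearMap ∘ₗ g) (b.equivFun.injective.comp hg)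
  obtain ⟨t, ht⟩ := hsurj (b.equivFun ((1 : T ⊗[O] E) ⊗ₜ[T] y))
  replace ht : g t = (1 : T ⊗[O] E) ⊗ₜ[T] y := b.equivFun.injective ht
  obtain ⟨⟨_, o, ho, rfl⟩, hs⟩ := IsLocalization.exist_integer_multiples_of_finite
    (Algebra.algebraMapSubmonoid T (nonZeroDivisors O)) t
  choose c hc using hs
  refine ⟨o, nonZeroDivisors.ne_zero ho, ?_⟩
  have hkey : o • y = ∑ i, c i • m i := by
    rw [← sub_eq_zero]
    apply eq_zero_of_one_tmul_eq_zero (O := O) (T := T) (E := E)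
    rw [TensorProduct.tmul_sub, TensorProduct.tmul_sum, sub_eq_zero, ← algebraMap_smul T o y,
      TensorProduct.tmul_smul, ← ht, Fintype.linearCombination_apply, Finset.smul_sum]
    refine Finset.sum_congr rfl fun i _ ↦ ?_
    rw [TensorProduct.tmul_smul, Function.comp_apply, TensorProduct.mk_apply, ← smul_assoc,
      ← algebraMap_smul (T ⊗[O] E) (c i), hc]
  rw [hkey]
  exact sum_mem fun i _ ↦ Submodule.smul_mem _ _ (Submodule.subset_span ⟨i, rfl⟩)

/-- In a generically free module of rank `d`, the elements annihilated by an augmentation ideal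
that is generically a direct factor have rank at most `d`. -/
theorem exists_smul_mem_span_of_ker_smul_eq_zero [Module.Finite T M]
    [Module.IsTorsionFree O M] [Module.Free (T ⊗[O] E) ((T ⊗[O] E) ⊗[T] M)]
    [Nontrivial (T ⊗[O] E)] {d : ℕ}
    (hd : Module.finrank (T ⊗[O] E) ((T ⊗[O] E) ⊗[T] M) = d) (f : T →ₐ[O] O) {z : T}
    (hz : ∀ t ∈ RingHom.ker f, t * z = 0) (hfz : f z ≠ 0) {b : Fin d → M}
    (hb : LinearIndependent O b) (hbf : ∀ i, ∀ t ∈ RingHom.ker f, t • b i = 0) {y : M}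
    (hy : ∀ t ∈ RingHom.ker f, t • y = 0) :
    ∃ o : O, o ≠ 0 ∧ o • y ∈ Submodule.span O (Set.range b) := by
  let β := Module.finBasisOfFinrankEq (T ⊗[O] E) ((T ⊗[O] E) ⊗[T] M) hd
  let fE : T ⊗[O] E →ₐ[O] E :=
    Algebra.TensorProduct.lift ((Algebra.ofId O E).comp f) (AlgHom.id O E) fun _ _ ↦ mul_comm _ _
  have hfE : ∀ s e, fE (s ⊗ₜ e) = algebraMap O E (f s) * e := by
    intro s e
    exact Algebra.TensorProduct.lift_tmul _ _ _ _ _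
  have hzE : ∀ t : T ⊗[O] E, (z ⊗ₜ[O] (1 : E)) * t = z ⊗ₜ[O] fE t := by
    intro t
    induction t with
    | zero => simp
    | add s t hs ht => rw [mul_add, hs, ht, map_add, TensorProduct.tmul_add]
    | tmul s e =>
      rw [hfE, Algebra.TensorProduct.tmul_mul_tmul, one_mul, mul_comm z,
        f.smul_eq_of_mul_ker_eq_zero hz, ← Algebra.smul_def, TensorProduct.smul_tmul]
  -- Generic coordinates pushed to `E` by the augmentation. On elements killed by `ker f` this is
  -- injective, since `z` acts there by `f z ≠ 0` while `z` times a coordinate depends only on its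
  -- augmentation.
  let Ψ : M →ₗ[O] (Fin d → E) :=
    { toFun := fun x i ↦ fE (β.repr ((1 : T ⊗[O] E) ⊗ₜ[T] x) i)
      map_add' := fun x x' ↦ by
        funext i
        simp [TensorProduct.tmul_add]
      map_smul' := fun o x ↦ by
        funext i
        have h1 : (1 : T ⊗[O] E) ⊗ₜ[T] (o • x) =
            (algebraMap T (T ⊗[O] E) (algebraMap O T o)) • ((1 : T ⊗[O] E) ⊗ₜ[T] x) := by
          rw [algebraMap_smul, ← TensorProduct.tmul_smul, algebraMap_smul]
        rw [h1, map_smul, Finsupp.smul_apply, smul_eq_mul, map_mul,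
          ← IsScalarTower.algebraMap_apply, fE.commutes, ← Algebra.smul_def]
        rfl }
  have hΨ : ∀ x : M, (∀ t ∈ RingHom.ker f, t • x = 0) → Ψ x = 0 → x = 0 := by
    intro x hx h0
    have h1 : (z ⊗ₜ[O] (1 : E)) • ((1 : T ⊗[O] E) ⊗ₜ[T] x) = 0 := by
      apply β.repr.injective
      ext i
      rw [map_smul, Finsupp.smul_apply, smul_eq_mul, hzE,
        show fE (β.repr ((1 : T ⊗[O] E) ⊗ₜ[T] x) i) = 0 from congrFun h0 i]
      simp
    have h2 : (z ⊗ₜ[O] (1 : E)) • ((1 : T ⊗[O] E) ⊗ₜ[T] x) = (1 : T ⊗[O] E) ⊗ₜ[T] (z • x) := by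
      rw [TensorProduct.tmul_smul, ← algebraMap_smul (T ⊗[O] E) z]
      rfl
    rw [h2] at h1
    have h3 := eq_zero_of_one_tmul_eq_zero h1
    have h4 := hx (z - algebraMap O T (f z)) (by
      rw [RingHom.mem_ker, map_sub, f.commutes, sub_eq_zero]; rfl)
    rw [sub_smul, h3, algebraMap_smul, zero_sub, neg_eq_zero] at h4
    exact (smul_eq_zero.1 h4).resolve_left hfz
  have hsum : ∀ g : Option (Fin d) → O, ∀ t ∈ RingHom.ker f,
      t • (∑ i, g i • (i.elim y b : M)) = 0 := by
    intro g t ht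
    rw [Finset.smul_sum]
    refine Finset.sum_eq_zero fun i _ ↦ ?_
    rw [smul_comm]
    cases i with
    | none => simp [hy t ht]
    | some i => simp [hbf i t ht]
  have hdep : ¬ LinearIndependent O (fun i : Option (Fin d) ↦ Ψ (i.elim y b)) := by
    intro hli
    rw [LinearIndependent.iff_fractionRing O E] at hli
    have := hli.fintype_card_le_finrank
    simp at this
  obtain ⟨g, hg, i, hi⟩ := Fintype.not_linearIndependent_iff.1 hdep
  have hg0 : ∑ i, g i • (i.elim y b : M) = 0 := by
    apply hΨ _ (hsum g)
    rw [map_sum, ← hg]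
    simp
  rw [Fintype.sum_option] at hg0
  simp only [Option.elim_none, Option.elim_some] at hg0
  refine ⟨g none, fun h0 ↦ ?_, ?_⟩
  · rw [h0, zero_smul, zero_add] at hg0
    have h5 := Fintype.linearIndependent_iff.1 hb _ hg0
    cases i with
    | none => exact hi h0
    | some i => exact hi (h5 i)
  · rw [eq_neg_of_add_eq_zero_left hg0]
    exact neg_mem (sum_mem fun i _ ↦ Submodule.smul_mem _ _ (Submodule.subset_span ⟨i, rfl⟩))

end GenericallyFree

/-! ### A functional normalised on the annihilator generator. -/

section Functional

variable {O T : Type*} [CommRing O] [IsDomain O] [IsDiscreteValuationRing O] [CommRing T]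
  [Algebra O T] [Module.Finite O T] [Module.Free O T]

theorem exists_linearMap_apply_eq_one {ϖ : O} (hϖ : maximalIdeal O = Ideal.span {ϖ}) {δ : T}
    (hδ : ∀ s, δ ≠ ϖ • s) : ∃ χ : T →ₗ[O] O, χ δ = 1 := by
  let b := Module.Free.chooseBasis O T
  by_cases h : ∃ i, IsUnit (b.repr δ i)
  · obtain ⟨i, u, hu⟩ := h
    refine ⟨(↑u⁻¹ : O) • b.coord i, ?_⟩
    rw [LinearMap.smul_apply, Module.Basis.coord_apply, ← hu, smul_eq_mul, Units.inv_mul]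
  · push Not at h
    have h1 : ∀ i, ∃ c, b.repr δ i = ϖ * c := by
      intro i
      have h2 : b.repr δ i ∈ maximalIdeal O := h i
      rw [hϖ, Ideal.mem_span_singleton] at h2
      exact h2
    choose c hc using h1
    exfalso
    refine hδ (∑ i, c i • b i) ?_
    refine (b.sum_repr δ).symm.trans ?_
    rw [Finset.smul_sum]
    refine Finset.sum_congr rfl fun i _ ↦ ?_
    rw [hc, smul_smul]

/-- The generator `δ` is not divisible by `ϖ`: the quotient would again be killed by `ker f`, hence
equal `r δ`, and `f δ ≠ 0` would make `ϖ` a unit. -/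
theorem exists_linearMap_apply_eq_one_of_annihilator {ϖ : O}
    (hϖ : maximalIdeal O = Ideal.span {ϖ}) (hϖ0 : ϖ ≠ 0) (f : T →ₐ[O] O) {δ : T}
    (hδ : ∀ t ∈ RingHom.ker f, t * δ = 0)
    (hgen : ∀ s, (∀ t ∈ RingHom.ker f, t * s = 0) → ∃ r : O, s = r • δ) (hfδ : f δ ≠ 0) :
    ∃ χ : T →ₗ[O] O, χ δ = 1 := by
  refine exists_linearMap_apply_eq_one hϖ fun s hs ↦ ?_
  obtain ⟨r, hr⟩ := hgen s fun t ht ↦ by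
    have := hδ t ht
    rw [hs, mul_smul_comm] at this
    exact (smul_eq_zero.1 this).resolve_left hϖ0
  rw [hr, smul_smul] at hs
  have h1 : f δ * (1 - ϖ * r) = 0 := by
    have := congrArg f hs
    rw [map_smul, smul_eq_mul] at this
    rw [mul_sub, mul_one, sub_eq_zero, mul_comm (f δ)]
    exact this
  have h2 := (mul_eq_zero.1 h1).resolve_left hfδ
  have h3 : ϖ ∈ maximalIdeal O := hϖ ▸ Ideal.mem_span_singleton_self ϖ
  exact h3 (IsUnit.of_mul_eq_one r (sub_eq_zero.1 h2).symm)

end Functional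

end

/-! ### Presentations with prescribed linear part. -/

section

open IsLocalRing MvPowerSeries Ideal

theorem exists_generators_ker {O R : Type*} [CommRing O] [IsDomain O] [IsDiscreteValuationRing O]
    [CommRing R] [Algebra O R] [IsLocalRing R] [IsNoetherianRing R] (ρ : R →ₐ[O] O)
    (hfin : Module.length O (RingHom.ker ρ).Cotangent ≠ ⊤) :
    ∃ (n : ℕ) (x : Fin n → R) (a : Fin n → O), RingHom.ker ρ = span (Set.range x) ∧
      (∀ i, a i ≠ 0) ∧ (∀ i, a i • x i ∈ RingHom.ker ρ ^ 2) ∧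
      Ring.ord O (∏ i, a i) = Module.length O (RingHom.ker ρ).Cotangent := by
  obtain ⟨n, g, a, hg, ha, hag, hord⟩ := Module.exists_generators_of_length_ne_top
    (IsDiscreteValuationRing.not_isField O) hfin
  choose x hx using fun i ↦ (RingHom.ker ρ).toCotangent_surjective (g i)
  refine ⟨n, fun i ↦ x i, a, le_antisymm ?_ ?_, ha, fun i ↦ ?_, hord⟩
  · have hm : RingHom.ker ρ ≤ jacobson ⊥ := by
      rw [jacobson_eq_maximalIdeal _ bot_ne_top]
      exact le_maximalIdeal (RingHom.ker_ne_top ρ)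
    refine Submodule.le_of_le_smul_of_le_jacobson_bot (IsNoetherian.noetherian _) hm ?_
    intro y hy
    have h1 : (RingHom.ker ρ).toCotangent ⟨y, hy⟩ ∈ Submodule.span R (Set.range g) :=
      Submodule.span_le_restrictScalars O R _ (hg ▸ Submodule.mem_top)
    obtain ⟨c, hc⟩ := (Submodule.mem_span_range_iff_exists_fun R).1 h1
    have h2 : (RingHom.ker ρ).toCotangent ⟨y, hy⟩ =
        (RingHom.ker ρ).toCotangent (∑ i, c i • x i) := by
      rw [← hc, map_sum]
      simp [hx]
    rw [toCotangent_eq] at h2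
    have h3 : y = (∑ i, c i * (x i : R)) + (y - ((∑ i, c i • x i : RingHom.ker ρ) : R)) := by
      simp
    rw [h3]
    refine add_mem (mem_sup_left ?_) (mem_sup_right ?_)
    · exact sum_mem fun i _ ↦ mul_mem_left _ _ (subset_span ⟨i, rfl⟩)
    · rw [smul_eq_mul, ← pow_two]
      exact h2
  · rw [span_le]
    rintro _ ⟨i, rfl⟩
    exact (x i).2
  · have h := hag i
    rw [← hx, ← algebraMap_smul R (a i), ← map_smul, toCotangent_eq_zero] at h
    rw [← algebraMap_smul R (a i)]
    exact h

/-- A presentation of `R` over `O` by power series, together with a regular sequence of relations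
holding in `T` and agreeing to first order with relations holding in `R`. -/
theorem exists_presentation {O R T : Type*} [CommRing O] [IsDomain O]
    [IsDiscreteValuationRing O] [CommRing R] [Algebra O R] [IsLocalRing R]
    [IsNoetherianRing R] [IsAdicComplete (maximalIdeal R) R] [CommRing T] [Algebra O T]
    [IsLocalRing T] [Module.Finite O T] {ϖ : O} (hϖ : maximalIdeal O = span {ϖ})
    (π : R →ₐ[O] T) (hπ : Function.Surjective π) (f : T →ₐ[O] O)
    (hfin : Module.length O (RingHom.ker (f.comp π)).Cotangent ≠ ⊤) :
    ∃ (n : ℕ) (Θ : MvPowerSeries (Fin n) O →ₐ[O] R) (a : Fin n → O)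
      (F : Fin n → MvPowerSeries (Fin n) O) (A : Matrix (Fin n) (Fin n) (MvPowerSeries (Fin n) O)),
      Function.Surjective Θ ∧ (∀ i, f (π (Θ (X i))) = 0) ∧ (∀ i, a i ≠ 0) ∧
      Ring.ord O (∏ i, a i) = Module.length O (RingHom.ker (f.comp π)).Cotangent ∧
      (∀ i, F i = ∑ j, A i j * X j) ∧
      (∀ i j, constantCoeff (A i j) = Matrix.diagonal a i j) ∧
      RegSeqMod (span {C ϖ}) (List.ofFn F) ∧ (∀ i, π (Θ (F i)) = 0) ∧
      ∀ i, ∃ g, Θ g = 0 ∧ F i - g ∈ span (Set.range X) ^ 2 := by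
  classical
  obtain ⟨n, x, a, hx, ha, hax, hord⟩ := exists_generators_ker (f.comp π) hfin
  have hxker : ∀ i, x i ∈ RingHom.ker (f.comp π) := fun i ↦ hx ▸ subset_span ⟨i, rfl⟩
  obtain ⟨Θ, hΘ⟩ := exists_algHom_X_eq (O := O) (I := maximalIdeal R) x
    fun i ↦ le_maximalIdeal (RingHom.ker_ne_top _) (hxker i)
  have hker : RingHom.ker (f.comp π) = span (Set.range fun i ↦ Θ (X i)) := by simp only [hΘ, hx]
  have hsurj := surjective_algHom_of_ker_eq (f.comp π) Θ hker
  have hmap : (span (Set.range X) ^ 2 : Ideal (MvPowerSeries (Fin n) O)).map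
      (Θ : MvPowerSeries (Fin n) O →+* R) = RingHom.ker (f.comp π) ^ 2 := by
    rw [Ideal.map_pow, map_span, ← Set.range_comp, hker]
    rfl
  have hg : ∀ i, ∃ g ∈ (span (Set.range X) ^ 2 : Ideal (MvPowerSeries (Fin n) O)),
      Θ g = a i • x i := by
    intro i
    have := hax i
    rw [← hmap] at this
    exact (mem_map_iff_of_surjective (Θ : MvPowerSeries (Fin n) O →+* R) hsurj).1 this
  choose g hg hgx using hg
  let F₀ : Fin n → MvPowerSeries (Fin n) O := fun i ↦ a i • X i - g i
  have hF₀ : ∀ i, Θ (F₀ i) = 0 := fun i ↦ by simp [F₀, hgx, hΘ]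
  -- The admissible corrections to `F₀`: they vanish in `T` and leave the linear part unchanged.
  let K : Ideal (MvPowerSeries (Fin n) O) := RingHom.ker (π.comp Θ) ⊓ span (Set.range X) ^ 2
  have hXm : span (Set.range X) ≤ maximalIdeal (MvPowerSeries (Fin n) O) := by
    rw [maximalIdeal_eq hϖ]; exact le_sup_right
  have hX2 : (span (Set.range X) ^ 2 : Ideal (MvPowerSeries (Fin n) O)) ≤ span (Set.range X) :=
    Ideal.pow_le_self two_ne_zero
  have hF₀X : ∀ i, F₀ i ∈ (span (Set.range X) : Ideal (MvPowerSeries (Fin n) O)) := fun i ↦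
    sub_mem (Submodule.smul_of_tower_mem _ _ (subset_span ⟨i, rfl⟩)) (hX2 (hg i))
  have : IsNoetherianRing T := IsNoetherianRing.of_finite O T
  obtain ⟨N, hN⟩ := exists_maximalIdeal_pow_le (O := O) (T := T) hϖ
  -- The `N` factors make the image in `T` divisible by `ϖ`; the two extra ones keep the resulting
  -- relation in `(X)^2`.
  have hXpow : ∀ i, (X i : MvPowerSeries (Fin n) O) ^ (N + 2) ∈ span {C ϖ} ⊔ K := by
    intro i
    have h1 : π (x i) ^ N ∈ span {algebraMap O T ϖ} := by
      refine hN (Ideal.pow_mem_pow ?_ N)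
      exact le_maximalIdeal (RingHom.ker_ne_top f) (hxker i)
    obtain ⟨t, ht⟩ := mem_span_singleton'.1 h1
    obtain ⟨b, hb⟩ := (hπ.comp hsurj) t
    have h2 : (X i : MvPowerSeries (Fin n) O) ^ (N + 2) =
        C ϖ * (X i ^ 2 * b) + X i ^ 2 * (X i ^ N - b * C ϖ) := by ring
    rw [h2]
    refine add_mem (mem_sup_left (mul_mem_right _ _ (mem_span_singleton_self _)))
      (mem_sup_right (Submodule.mem_inf.2 ⟨mul_mem_left _ _ ?_,
        mul_mem_right _ _ (Ideal.pow_mem_pow (subset_span (Set.mem_range_self i)) 2)⟩))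
    have h3 : (π.comp Θ) (C ϖ) = algebraMap O T ϖ := (π.comp Θ).commutes ϖ
    have h4 : (π.comp Θ) b = t := hb
    rw [RingHom.mem_ker, map_sub, map_mul, map_pow, h3, h4, ht, AlgHom.comp_apply, hΘ, sub_self]
  have hIm : span {C ϖ} ≤ maximalIdeal (MvPowerSeries (Fin n) O) := by
    rw [maximalIdeal_eq hϖ]; exact le_sup_left
  obtain ⟨zs, hzs, hreg⟩ := RegSeqMod.exchange (K := K) (ys := List.ofFn F₀)
    (gs := (List.ofFn X).map (· ^ (N + 2))) hIm (inf_le_right.trans (hX2.trans hXm))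
    (by
      intro y hy
      obtain ⟨i, rfl⟩ := (List.mem_ofFn' _ _).1 hy
      exact hXm (hF₀X i))
    ((regSeqMod_ofFn_X ϖ).pow (by
      intro y hy
      obtain ⟨i, rfl⟩ := (List.mem_ofFn' _ _).1 hy
      exact X_mem_maximalIdeal i) (by simp))
    (by simp)
    (by
      intro y hy
      obtain ⟨y', hy', rfl⟩ := List.mem_map.1 hy
      obtain ⟨i, rfl⟩ := (List.mem_ofFn' _ _).1 hy'
      exact sup_le_sup_right le_sup_left K (hXpow i))
  obtain ⟨F, rfl⟩ := exists_ofFn_eq (n := n) zs (by simpa using hzs.length_eq)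
  have hFK : ∀ i, F i - F₀ i ∈ K := by
    intro i
    have := hzs.get (i := i) (by simp) (by simp)
    simpa using this
  have hFg : ∀ i, a i • X i - F i ∈ (span (Set.range X) ^ 2 : Ideal (MvPowerSeries (Fin n) O)) := by
    intro i
    have h1 : a i • X i - F i = g i - (F i - F₀ i) := by simp only [F₀]; ring
    rw [h1]
    exact sub_mem (hg i) (hFK i).2
  choose G hG0 hG using fun i ↦ exists_of_mem_span_range_X_sq (hFg i)
  refine ⟨n, Θ, a, F, fun i j ↦ Matrix.diagonal (fun i ↦ C (a i)) i j - G i j, hsurj, fun i ↦ ?_, ha,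
    hord, fun i ↦ ?_, fun i j ↦ ?_, hreg, fun i ↦ ?_, fun i ↦ ⟨F₀ i, hF₀ i, (hFK i).2⟩⟩
  · rw [hΘ]; exact hxker i
  · have h1 : F i = a i • X i - (a i • X i - F i) := by ring
    rw [h1, hG]
    simp only [sub_mul, Finset.sum_sub_distrib]
    congr 1
    rw [Finset.sum_eq_single i (fun j _ hj ↦ by rw [Matrix.diagonal_apply_ne' _ hj, zero_mul])
      (by simp), Matrix.diagonal_apply_eq, smul_eq_C_mul]
  · rw [map_sub, hG0, sub_zero, Matrix.diagonal_apply, Matrix.diagonal_apply]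
    split_ifs <;> simp
  · have h1 : (π.comp Θ) (F i - F₀ i) = 0 := (hFK i).1
    rw [map_sub, sub_eq_zero] at h1
    have h2 : π (Θ (F i)) = π (Θ (F₀ i)) := h1
    rw [h2, hF₀, map_zero]

end

/-! ### Relations between the `m i`: the socle argument and its lift along `ϖ`. -/

section

open IsLocalRing MvPowerSeries Ideal

theorem Ideal.RegSeqMod.isRegular {B : Type*} [CommRing B] [IsLocalRing B] {xs : List B}
    (hm : ∀ x ∈ xs, x ∈ maximalIdeal B) (h : RegSeqMod ⊥ xs) :
    RingTheory.Sequence.IsRegular B xs := by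
  refine ⟨isWeaklyRegular_iff_regSeqMod.2 h, ?_⟩
  rw [smul_eq_mul, mul_top]
  exact ne_of_gt (lt_of_le_of_lt (ofList_le.2 hm) (maximalIdeal.isMaximal B).ne_top.lt_top)

/-- A regular sequence which is as long as a system of generators of the maximal ideal generates
an ideal of definition. -/
theorem exists_maximalIdeal_pow_le_ofList {B : Type*} [CommRing B] [IsLocalRing B]
    [IsNoetherianRing B] {xs ys : List B} (hm : ∀ x ∈ xs, x ∈ maximalIdeal B)
    (h : RegSeqMod ⊥ xs) (hys : maximalIdeal B = ofList ys) (hlen : xs.length = ys.length) :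
    ∃ N, maximalIdeal B ^ N ≤ ofList xs := by
  classical
  have h1 := ringKrullDim_add_length_eq_ringKrullDim_of_isRegular xs (RegSeqMod.isRegular hm h)
  have h2 : ringKrullDim B ≤ xs.length := by
    refine (ringKrullDim_le_spanFinrank_maximalIdeal (R := B)).trans ?_
    rw [hlen, hys, ofList]
    have h3 := Submodule.spanFinrank_span_le_ncard_of_finite (R := B) (s := {y | y ∈ ys})
      ys.finite_toSet
    have h4 : ({y | y ∈ ys} : Set B).ncard ≤ ys.length := by
      rw [← List.coe_toFinset, Set.ncard_coe_finset]
      exact List.toFinset_card_le ys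
    exact_mod_cast h3.trans h4
  have h5 : ringKrullDim (B ⧸ ofList xs) ≤ 0 := by
    rw [← h1] at h2
    generalize ringKrullDim (B ⧸ ofList xs) = D at h2
    induction D with
    | bot => exact bot_le
    | coe D =>
      induction D with
      | top =>
        exfalso
        have h3 : (⊤ : ℕ∞) + xs.length ≤ xs.length := by exact_mod_cast h2
        simp at h3
      | coe k =>
        have h3 : k + xs.length ≤ xs.length := by exact_mod_cast h2
        have h4 : k = 0 := by omega
        simp [h4]
  have h6 : Ring.KrullDimLE 0 (B ⧸ ofList xs) := Ring.krullDimLE_iff.2 (by simpa using h5)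
  have h7 : IsArtinianRing (B ⧸ ofList xs) := IsNoetherianRing.isArtinianRing_of_krullDimLE_zero
  have h8 : ofList xs ≠ ⊤ :=
    ne_of_lt (lt_of_le_of_lt (ofList_le.2 hm) (maximalIdeal.isMaximal B).ne_top.lt_top)
  have : Nontrivial (B ⧸ ofList xs) := Ideal.Quotient.nontrivial_iff.2 h8
  have : IsLocalRing (B ⧸ ofList xs) :=
    IsLocalRing.of_surjective' (Ideal.Quotient.mk _) Ideal.Quotient.mk_surjective
  obtain ⟨N, hN⟩ := (isArtinianRing_iff_isNilpotent_maximalIdeal (B ⧸ ofList xs)).1 h7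
  refine ⟨N, ?_⟩
  have h9 : (maximalIdeal B).map (Ideal.Quotient.mk (ofList xs)) ≤ maximalIdeal _ := by
    rw [map_le_iff_le_comap]
    exact (eq_maximalIdeal (comap_isMaximal_of_surjective _ Ideal.Quotient.mk_surjective)).ge
  rw [← Ideal.mk_ker (I := ofList xs), RingHom.ker, ← map_le_iff_le_comap, Ideal.map_pow]
  exact (Ideal.pow_right_mono h9 N).trans hN.le

section Relations

variable {O : Type*} [CommRing O] {ϖ : O} {n d : ℕ}
  {F : Fin n → MvPowerSeries (Fin n) O} {A : Matrix (Fin n) (Fin n) (MvPowerSeries (Fin n) O)}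

theorem mem_span_X_of_eq_sum (hF : ∀ i, F i = ∑ j, A i j * X j)
    (i : Fin n) : F i ∈ (span (Set.range X) : Ideal (MvPowerSeries (Fin n) O)) := by
  rw [hF]
  exact sum_mem fun j _ ↦ mul_mem_left _ _ (subset_span ⟨j, rfl⟩)

variable [IsDomain O]

theorem regSeqMod_C_cons (hϖ0 : ϖ ≠ 0) (hreg : RegSeqMod (span {C ϖ}) (List.ofFn F)) :
    RegSeqMod ⊥ (C ϖ :: List.ofFn F) := by
  refine ⟨fun b hb ↦ ?_, by rwa [bot_sup_eq]⟩
  rw [mem_bot, mul_eq_zero] at hb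
  rcases hb with hb | hb
  · exact absurd (by simpa using congrArg constantCoeff hb) hϖ0
  · exact hb

variable [IsDiscreteValuationRing O]

theorem mem_maximalIdeal_of_eq_sum (hϖ : maximalIdeal O = span {ϖ})
    (hF : ∀ i, F i = ∑ j, A i j * X j) (i : Fin n) : F i ∈ maximalIdeal (MvPowerSeries (Fin n) O) := by
  rw [maximalIdeal_eq hϖ]
  exact mem_sup_right (mem_span_X_of_eq_sum hF i)

theorem mem_maximalIdeal_of_mem_C_cons (hϖ : maximalIdeal O = span {ϖ})
    (hF : ∀ i, F i = ∑ j, A i j * X j) : ∀ x ∈ C ϖ :: List.ofFn F,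
      x ∈ maximalIdeal (MvPowerSeries (Fin n) O) := by
  intro x hx
  rcases List.mem_cons.1 hx with rfl | hx
  · rw [maximalIdeal_eq hϖ]
    exact mem_sup_left (mem_span_singleton_self _)
  · obtain ⟨i, rfl⟩ := (List.mem_ofFn' _ _).1 hx
    exact mem_maximalIdeal_of_eq_sum hϖ hF i

theorem isRegular_ofFn (hϖ : maximalIdeal O = span {ϖ}) (hϖ0 : ϖ ≠ 0)
    (hF : ∀ i, F i = ∑ j, A i j * X j) (hreg : RegSeqMod (span {C ϖ}) (List.ofFn F)) :
    RingTheory.Sequence.IsRegular (MvPowerSeries (Fin n) O) (List.ofFn F) := by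
  have hm := mem_maximalIdeal_of_mem_C_cons hϖ hF
  exact RegSeqMod.isRegular (fun x hx ↦ hm x (List.mem_cons_of_mem _ hx))
    ((regSeqMod_C_cons hϖ0 hreg).concat_of_cons (hm _ List.mem_cons_self)
      fun x hx ↦ hm x (List.mem_cons_of_mem _ hx)).1

/-- A nonzero submodule over an Artinian local ring meets the socle. The socle of the free module
over `B/(ϖ, F)` consists of constant multiples of `det A`, and `hdet` excludes the nonzero ones from
`W`. The induction is on the power of the maximal ideal that kills `r`. -/
theorem mem_sup_span_of_mem (hϖ : maximalIdeal O = span {ϖ}) (hϖ0 : ϖ ≠ 0)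
    (hF : ∀ i, F i = ∑ j, A i j * X j) (hreg : RegSeqMod (span {C ϖ}) (List.ofFn F))
    (W : Submodule (MvPowerSeries (Fin n) O) (Fin d → MvPowerSeries (Fin n) O))
    (hW : ∀ r, (∀ i, r i ∈ span {C ϖ} ⊔ span (Set.range F)) → r ∈ W)
    (hdet : ∀ c : Fin d → O, (fun i ↦ C (c i) * A.det) ∈ W → ∀ i, ϖ ∣ c i)
    {r : Fin d → MvPowerSeries (Fin n) O} (hr : r ∈ W) (i : Fin d) :
    r i ∈ span {C ϖ} ⊔ span (Set.range F) := by
  obtain ⟨N, hN⟩ : ∃ N, maximalIdeal (MvPowerSeries (Fin n) O) ^ N ≤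
      span {C ϖ} ⊔ span (Set.range F) := by
    have := exists_maximalIdeal_pow_le_ofList (mem_maximalIdeal_of_mem_C_cons hϖ hF)
      (regSeqMod_C_cons hϖ0 hreg) (ys := C ϖ :: List.ofFn X)
      (by rw [ofList_cons, ofList_ofFn, maximalIdeal_eq hϖ]) (by simp)
    rwa [ofList_cons, ofList_ofFn] at this
  have key : ∀ k, ∀ r ∈ W, (∀ i, ∀ u ∈ maximalIdeal (MvPowerSeries (Fin n) O) ^ k,
      u * r i ∈ span {C ϖ} ⊔ span (Set.range F)) →
      ∀ i, r i ∈ span {C ϖ} ⊔ span (Set.range F) := by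
    intro k
    induction k with
    | zero => exact fun r _ h i ↦ by simpa using h i 1 (by simp)
    | succ k ih =>
      intro r hr h
      have h1 : ∀ j i, X j * r i ∈ span {C ϖ} ⊔ span (Set.range F) := by
        intro j
        refine ih (X j • r) (W.smul_mem _ hr) fun i u hu ↦ ?_
        rw [Pi.smul_apply, smul_eq_mul, ← mul_assoc]
        exact h i _ (by rw [pow_succ]; exact mul_mem_mul hu (X_mem_maximalIdeal j))
      have hIm : span {C ϖ} ≤ maximalIdeal (MvPowerSeries (Fin n) O) := by
        rw [maximalIdeal_eq hϖ]; exact le_sup_left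
      have h2 : ∀ i, ∃ c, r i - c * A.det ∈ span {C ϖ} ⊔ span (Set.range F) := fun i ↦
        mem_sup_span_singleton_iff.1 (RegSeqMod.mem_sup_span_det hIm
          (mem_maximalIdeal_of_eq_sum hϖ hF) X_mem_maximalIdeal hreg A
          (fun i ↦ by rw [hF, sub_self]; exact zero_mem _)
          (fun j ↦ by rw [mul_comm]; exact h1 j i))
      choose c hc using h2
      -- Only the constant term of `c i` matters, because each `X j` times `det A` is in `(F)`.
      have h3 : ∀ i, r i - C (constantCoeff (c i)) * A.det ∈
          span {C ϖ} ⊔ span (Set.range F) := by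
        intro i
        have h4 : r i - C (constantCoeff (c i)) * A.det =
            (r i - c i * A.det) + A.det * (c i - C (constantCoeff (c i))) := by ring
        rw [h4]
        refine add_mem (hc i) (mem_sup_right ?_)
        have h5 : c i - C (constantCoeff (c i)) ∈ span (Set.range X) := by
          rw [mem_span_range_X_iff]; simp
        obtain ⟨g, hg⟩ := (Submodule.mem_span_range_iff_exists_fun _).1 h5
        rw [← hg, Finset.mul_sum]
        refine sum_mem fun j _ ↦ ?_
        rw [smul_eq_mul, mul_left_comm]
        exact mul_mem_left _ _ (det_mul_mem_span_range (fun i ↦ (hF i).symm) j)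
      have h4 : (fun i ↦ C (constantCoeff (c i)) * A.det) ∈ W := by
        have h5 := W.sub_mem hr (hW _ h3)
        convert h5 using 1
        funext i
        simp
      intro i
      obtain ⟨o, ho⟩ := hdet _ h4 i
      have h5 := add_mem (h3 i) (mem_sup_left (T := span (Set.range F)) (mul_mem_right
        (C o * A.det) _ (mem_span_singleton_self (C (σ := Fin n) ϖ))))
      rw [ho, map_mul] at h5
      convert h5 using 1
      ring
  exact key N r hr (fun i u hu ↦ mul_mem_right _ _ (hN hu)) i

/-- The result modulo `ϖ` and the saturation `htors` give `W₀ ⊆ (F)^d + ϖ W₀`; Nakayama removes the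
second term. -/
theorem mem_span_of_mem (hϖ : maximalIdeal O = span {ϖ}) (hϖ0 : ϖ ≠ 0)
    (hF : ∀ i, F i = ∑ j, A i j * X j) (hreg : RegSeqMod (span {C ϖ}) (List.ofFn F))
    (W W₀ : Submodule (MvPowerSeries (Fin n) O) (Fin d → MvPowerSeries (Fin n) O))
    (hW : ∀ r, (∀ i, r i ∈ span {C ϖ} ⊔ span (Set.range F)) → r ∈ W)
    (hdet : ∀ c : Fin d → O, (fun i ↦ C (c i) * A.det) ∈ W → ∀ i, ϖ ∣ c i)
    (hW₀W : W₀ ≤ W) (hW₀ : ∀ r, (∀ i, r i ∈ span (Set.range F)) → r ∈ W₀)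
    (htors : ∀ r : Fin d → MvPowerSeries (Fin n) O, C (σ := Fin n) ϖ • r ∈ W₀ → r ∈ W₀)
    {r : Fin d → MvPowerSeries (Fin n) O} (hr : r ∈ W₀) (i : Fin d) :
    r i ∈ span (Set.range F) := by
  let V : Submodule (MvPowerSeries (Fin n) O) (Fin d → MvPowerSeries (Fin n) O) :=
    Submodule.pi Set.univ fun _ ↦ span (Set.range F)
  have hjac : span {C ϖ} ≤ jacobson (⊥ : Ideal (MvPowerSeries (Fin n) O)) := by
    rw [jacobson_eq_maximalIdeal _ bot_ne_top, maximalIdeal_eq hϖ]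
    exact le_sup_left
  have hle : W₀ ≤ V := by
    refine Submodule.le_of_le_smul_of_le_jacobson_bot (IsNoetherian.noetherian _) hjac ?_
    intro s hs
    have h1 : ∀ i, ∃ c, s i - C ϖ * c ∈ span (Set.range F) := by
      intro i
      have := mem_sup_span_of_mem hϖ hϖ0 hF hreg W hW hdet (hW₀W hs) i
      rw [sup_comm, mem_sup_span_singleton_iff] at this
      simpa only [mul_comm] using this
    choose c hc using h1
    have h2 : s = (s - C (σ := Fin n) ϖ • c) + C (σ := Fin n) ϖ • c := by abel
    rw [h2]
    refine add_mem (Submodule.mem_sup_left fun i _ ↦ hc i)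
      (Submodule.mem_sup_right (Submodule.smul_mem_smul (mem_span_singleton_self _) (htors _ ?_)))
    have h3 := W₀.sub_mem hs (hW₀ _ hc)
    convert h3 using 1
    funext i
    simp
  exact hle hr i trivial

end Relations

end

/-! ### The pairing, the adjoint of `ξ`, and the key divisibility. -/

section

open IsLocalRing


theorem nontrivial_tensorProduct {O T E : Type*} [CommRing O] [CommRing T] [Algebra O T] [Field E]
    [Algebra O E] (f : T →ₐ[O] O) :
    Nontrivial (T ⊗[O] E) :=
  (Algebra.TensorProduct.lift ((Algebra.ofId O E).comp f) (AlgHom.id O E)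
    fun _ _ ↦ mul_comm _ _).toRingHom.domain_nontrivial

namespace AdmissibleQuintet

section Pairing

variable {O : Type u} [CommRing O] [IsLocalRing O] (Q : AdmissibleQuintet.{u, v₁, v₂, v₃} O)

theorem eq_of_forall_pairing_eq {y z : Q.M} (h : ∀ x, Q.pairing x y = Q.pairing x z) : y = z :=
  (LinearMap.IsPerfPair.bijective_right Q.pairing).injective (LinearMap.ext h)

theorem exists_pairing_eq (g : Q.M →ₗ[O] O) : ∃ y, ∀ x, Q.pairing x y = g x := by
  obtain ⟨y, hy⟩ := (LinearMap.IsPerfPair.bijective_right Q.pairing).surjective g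
  exact ⟨y, fun x ↦ LinearMap.congr_fun hy x⟩

end Pairing

namespace Hom

section General

variable {O : Type u} [CommRing O] [IsLocalRing O] {Q' : AdmissibleQuintet.{u, w₁, w₂, w₃} O}
  {Q : AdmissibleQuintet.{u, v₁, v₂, v₃} O} (φ : Hom Q' Q)

theorem ξDual_smul (t' : Q'.T) (y : Q'.M) : φ.ξDual (t' • y) = φ.β t' • φ.ξDual y := by
  refine Q.eq_of_forall_pairing_eq fun x ↦ ?_
  rw [← pairing_ξ, ← Q'.pairing_smul, ← φ.ξ_smul, pairing_ξ, Q.pairing_smul]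

theorem exists_leftInverse : ∃ η : Q'.M →ₗ[O] Q.M, ∀ x, η (φ.ξ x) = x := by
  obtain ⟨N, hN⟩ := φ.ξ_directSummand
  refine ⟨(LinearEquiv.ofInjective φ.ξ φ.ξ_injective).symm.toLinearMap ∘ₗ
    Submodule.projectionOnto _ _ hN, fun x ↦ ?_⟩
  have h := Submodule.projectionOnto_apply_left hN ⟨φ.ξ x, x, rfl⟩
  rw [LinearMap.comp_apply, h, LinearEquiv.coe_coe, LinearEquiv.symm_apply_eq]
  rfl

/-- Supplies the future basis of `M'`. The functional `χ` applied to the `i`-th coordinate extends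
to `M'` because `ξ` splits over `O`, and perfectness represents it by an element. -/
theorem exists_pairing_ξ_smul_basis {d : ℕ} (e : Module.Basis (Fin d) Q.T Q.M) (χ : Q.T →ₗ[O] O)
    {δ : Q.T} (hχ : χ δ = 1) : ∃ m : Fin d → Q'.M, ∀ i j,
      Q'.pairing (φ.ξ (δ • e j)) (m i) = if j = i then 1 else 0 := by
  obtain ⟨η, hη⟩ := φ.exists_leftInverse
  choose m hm using fun i ↦ Q'.exists_pairing_eq (χ ∘ₗ (e.coord i).restrictScalars O ∘ₗ η)
  refine ⟨m, fun i j ↦ ?_⟩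
  rw [hm, LinearMap.comp_apply, LinearMap.comp_apply, hη, LinearMap.restrictScalars_apply, map_smul,
    Module.Basis.coord_apply, Module.Basis.repr_self, Finsupp.single_apply]
  split_ifs <;> simp [hχ]

end General

section Domain

variable {O : Type u} [CommRing O] [IsDomain O] [IsLocalRing O] [IsNoetherianRing O] {E : Type*}
  [Field E] [Algebra O E]
  [IsFractionRing O E] {Q' : AdmissibleQuintet.{u, w₁, w₂, w₃} O}
  {Q : AdmissibleQuintet.{u, v₁, v₂, v₃} O} (φ : Hom Q' Q) (f : Q.T →ₐ[O] O)

/-- The `d` elements `ξ(δ e_j)` are independent, and `d` bounds the rank of the part of `M'` killed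
by the augmentation ideal. So a nonzero multiple of `y'` lies in the image of `ξ`, which is
saturated as a direct summand. -/
theorem exists_ξ_eq [IsReduced Q'.T]
    [Module.Free (Q'.T ⊗[O] E) ((Q'.T ⊗[O] E) ⊗[Q'.T] Q'.M)] {d : ℕ}
    (hd : Module.finrank (Q'.T ⊗[O] E) ((Q'.T ⊗[O] E) ⊗[Q'.T] Q'.M) = d)
    (e : Module.Basis (Fin d) Q.T Q.M) {δ : Q.T} (hδ : ∀ t ∈ RingHom.ker f, t * δ = 0)
    {m : Fin d → Q'.M}
    (hm : ∀ i j, Q'.pairing (φ.ξ (δ • e j)) (m i) = if j = i then 1 else 0) {y' : Q'.M}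
    (hy' : ∀ t ∈ RingHom.ker (f.comp φ.β), t • y' = 0) :
    ∃ y, φ.ξ y = y' ∧ ∀ t ∈ RingHom.ker f, t • y = 0 := by
  have := nontrivial_tensorProduct (E := E) (f.comp φ.β)
  have : IsNoetherianRing Q'.T := IsNoetherianRing.of_finite O Q'.T
  obtain ⟨η, hη⟩ := φ.exists_leftInverse
  obtain ⟨z, hz, hfz⟩ := exists_annihilator_ker (f.comp φ.β)
  have hb : LinearIndependent O fun j ↦ φ.ξ (δ • e j) := by
    rw [Fintype.linearIndependent_iff]
    intro c hc i
    have h1 := LinearMap.congr_fun (congrArg Q'.pairing hc) (m i)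
    simpa [hm] using h1
  have hbf : ∀ i, ∀ t ∈ RingHom.ker (f.comp φ.β), t • φ.ξ (δ • e i) = 0 := by
    intro i t ht
    rw [← φ.ξ_smul, ← mul_smul, hδ (φ.β t) ht, zero_smul, map_zero]
  obtain ⟨o, ho, hoy⟩ := exists_smul_mem_span_of_ker_smul_eq_zero (E := E) hd (f.comp φ.β) hz hfz hb
    hbf hy'
  have h1 : Submodule.span O (Set.range fun j ↦ φ.ξ (δ • e j)) ≤ LinearMap.range φ.ξ := by
    rw [Submodule.span_le]
    rintro _ ⟨j, rfl⟩
    exact ⟨_, rfl⟩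
  obtain ⟨w, hw⟩ := h1 hoy
  have h2 : φ.ξ (η y') = y' := by
    have h3 : w = o • η y' := by rw [← hη w, hw, map_smul]
    rw [h3, map_smul, ← sub_eq_zero, ← smul_sub] at hw
    exact sub_eq_zero.1 ((smul_eq_zero.1 hw).resolve_left ho)
  refine ⟨η y', h2, fun t ht ↦ ?_⟩
  obtain ⟨t', rfl⟩ := φ.β_surjective t
  apply φ.ξ_injective
  rw [φ.ξ_smul, h2, map_zero]
  exact hy' t' ht

/-- Here `y' = ξ(y)`, and `ξ^∨(y') = Δ z = f(Δ) z` because `z` too is killed by `ker f`. Applying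
`ξ^∨` to `h` and pairing with `e l` yields `s c_l = ϖ f(Δ) ⟨e l, z⟩`, where `s` cancels. -/
theorem dvd_of_sum_smul_eq_smul [IsReduced Q'.T]
    [Module.Free (Q'.T ⊗[O] E) ((Q'.T ⊗[O] E) ⊗[Q'.T] Q'.M)] {d : ℕ}
    (hd : Module.finrank (Q'.T ⊗[O] E) ((Q'.T ⊗[O] E) ⊗[Q'.T] Q'.M) = d)
    (e : Module.Basis (Fin d) Q.T Q.M) {δ : Q.T} (hδ : ∀ t ∈ RingHom.ker f, t * δ = 0)
    {m : Fin d → Q'.M}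
    (hm : ∀ i j, Q'.pairing (φ.ξ (δ • e j)) (m i) = if j = i then 1 else 0)
    {Δ : Q.T} (hΔ : Δ ∈ nonZeroDivisors Q.T) (hξ : ∀ y, ∃ z, φ.ξDual (φ.ξ y) = Δ • z)
    {D : Q'.T} (hD : ∀ t ∈ RingHom.ker (f.comp φ.β), t * D = 0) {s : O} (hs : s ≠ 0)
    (hsD : φ.β D = s • δ) (hsΔ : s ∣ f Δ) {ϖ : O} (hϖ : ϖ ≠ 0) {c : Fin d → O} {y' : Q'.M}
    (h : ∑ i, c i • D • m i = ϖ • y') (l : Fin d) : ϖ ∣ c l := by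
  have hy' : ∀ t ∈ RingHom.ker (f.comp φ.β), t • y' = 0 := by
    intro t ht
    have h1 := congrArg (t • ·) h
    simp only [Finset.smul_sum] at h1
    rw [Finset.sum_eq_zero fun i _ ↦ by rw [smul_comm, ← mul_smul, hD t ht, zero_smul, smul_zero],
      smul_comm] at h1
    exact (smul_eq_zero.1 h1.symm).resolve_left hϖ
  obtain ⟨y, rfl, hy⟩ := φ.exists_ξ_eq f hd e hδ hm hy'
  obtain ⟨z, hz⟩ := hξ y
  have hzf : ∀ t ∈ RingHom.ker f, t • z = 0 := by
    intro t ht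
    have h1 : Δ • t • z = 0 := by
      obtain ⟨t', rfl⟩ := φ.β_surjective t
      rw [smul_comm, ← hz, ← ξDual_smul, ← φ.ξ_smul, hy _ ht, map_zero, map_zero]
    apply e.repr.injective
    ext i
    have h2 := congrArg (fun w ↦ e.repr w i) h1
    simp only [map_smul, Finsupp.smul_apply, smul_eq_mul, map_zero, Finsupp.zero_apply] at h2 ⊢
    exact (mem_nonZeroDivisors_iff.1 hΔ).1 _ h2
  have hΔz : Δ • z = f Δ • z := by
    have h1 := hzf (Δ - algebraMap O Q.T (f Δ)) (by
      rw [RingHom.mem_ker, map_sub, f.commutes, sub_eq_zero]; rfl)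
    rwa [sub_smul, algebraMap_smul, sub_eq_zero] at h1
  have h1 := congrArg (fun w ↦ Q.pairing (e l) (φ.ξDual w)) h
  simp only [map_sum, map_smul, ξDual_smul, hz, hsD, hΔz, smul_eq_mul] at h1
  have h2 : ∀ i, Q.pairing (e l) ((s • δ) • φ.ξDual (m i)) = s * if l = i then 1 else 0 := by
    intro i
    rw [smul_assoc, map_smul, smul_eq_mul, ← Q.pairing_smul, ← pairing_ξ, hm]
  simp only [h2, mul_ite, mul_one, mul_zero, Finset.sum_ite_eq, Finset.mem_univ, if_true] at h1
  obtain ⟨s', hs'⟩ := hsΔ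
  refine ⟨s' * Q.pairing (e l) z, mul_left_cancel₀ hs ?_⟩
  rw [mul_comm s, h1, hs']
  ring

end Domain

end Hom

end AdmissibleQuintet

end

/-! ### Freeness over `T'` and comparison of the relations of `R'` and `T'`. -/

section

open IsLocalRing MvPowerSeries Ideal

theorem Module.free_compHom_iff {R T M : Type*} [CommRing R] [CommRing T] [AddCommGroup M]
    [Module T M] (π : R →+* T) (hπ : Function.Bijective π) :
    (letI : Module R M := Module.compHom M π; Module.Free R M) ↔ Module.Free T M := by
  let _ : Module R M := Module.compHom M π
  let e := RingEquiv.ofBijective π hπ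
  constructor
  · intro h
    exact Module.Free.of_basis ((Module.Free.chooseBasis R M).mapCoeffs e fun c x ↦ rfl)
  · intro h
    refine Module.Free.of_basis ((Module.Free.chooseBasis T M).mapCoeffs e.symm fun c x ↦ ?_)
    change π (e.symm c) • x = c • x
    congr 1
    exact e.apply_symm_apply c

theorem injective_of_free_compHom {R T M : Type*} [CommRing R] [CommRing T] [AddCommGroup M]
    [Module T M] [Nontrivial M] (π : R →+* T)
    (h : letI : Module R M := Module.compHom M π; Module.Free R M) : Function.Injective π := by
  let _ : Module R M := Module.compHom M π
  have : Module.Free R M := h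
  rw [injective_iff_map_eq_zero]
  intro r hr
  let b := Module.Free.chooseBasis R M
  obtain ⟨i⟩ := b.index_nonempty
  have h1 : r • b i = 0 := by
    change π r • b i = 0
    rw [hr, zero_smul]
  simpa using congrArg (fun x ↦ b.repr x i) h1

/-- Write `F i - g = ∑ c_k F k`. The linear coefficient at `X k` is `a k` times the constant term of
`c_k`, and it vanishes, so `c_k` lies in `(X)`. Thus `(F) ⊆ J + (X)(F)`, and Nakayama applies. -/
theorem MvPowerSeries.span_le_of_sub_mem_sq {O : Type*} [CommRing O] [IsDomain O] [IsLocalRing O]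
    [IsNoetherianRing O] {n : ℕ} {F : Fin n → MvPowerSeries (Fin n) O}
    {A : Matrix (Fin n) (Fin n) (MvPowerSeries (Fin n) O)} (hF : ∀ i, F i = ∑ j, A i j * X j)
    {a : Fin n → O} (ha : ∀ i, a i ≠ 0)
    (hA : ∀ i j, constantCoeff (A i j) = Matrix.diagonal a i j)
    {J : Ideal (MvPowerSeries (Fin n) O)} (hJ : J ≤ span (Set.range F))
    (h : ∀ i, ∃ g ∈ J, F i - g ∈ span (Set.range X) ^ 2) : span (Set.range F) ≤ J := by
  have hX : span (Set.range X) ≤ jacobson (⊥ : Ideal (MvPowerSeries (Fin n) O)) := by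
    rw [jacobson_eq_maximalIdeal _ bot_ne_top, span_le]
    rintro _ ⟨i, rfl⟩
    exact X_mem_maximalIdeal i
  refine Submodule.le_of_le_smul_of_le_jacobson_bot (IsNoetherian.noetherian _) hX ?_
  rw [span_le]
  rintro _ ⟨i, rfl⟩
  obtain ⟨g, hg, hFg⟩ := h i
  obtain ⟨c, hc⟩ := mem_span_range_iff_exists_fun.1
    (sub_mem (subset_span (Set.mem_range_self i)) (hJ hg))
  have h1 : F i = g + ∑ k, c k * F k := by rw [hc]; ring
  rw [SetLike.mem_coe, h1]
  refine add_mem (mem_sup_left hg) (mem_sup_right (sum_mem fun k _ ↦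
    Submodule.smul_mem_smul ?_ (subset_span ⟨k, rfl⟩)))
  have h2 := coeff_single_of_mem_span_range_X_sq hFg k
  rw [← hc] at h2
  simp only [hF, Finset.mul_sum, ← mul_assoc, map_sum, coeff_single_mul_X, map_mul, hA,
    Finset.sum_ite_eq, Finset.mem_univ, if_true] at h2
  rw [Finset.sum_eq_single k (fun j _ hj ↦ by rw [Matrix.diagonal_apply_ne _ hj, mul_zero])
    (by simp), Matrix.diagonal_apply_eq] at h2
  rw [mem_span_range_X_iff]
  exact (mul_eq_zero.1 h2).resolve_right (ha k)

section Generation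

variable {O T M : Type*} [CommRing O] [IsDomain O] [IsDiscreteValuationRing O] [CommRing T]
  [Algebra O T] [AddCommGroup M] [Module T M] [Module O M] [IsScalarTower O T M] {ϖ : O}
  {n d : ℕ} {F : Fin n → MvPowerSeries (Fin n) O}
  {A : Matrix (Fin n) (Fin n) (MvPowerSeries (Fin n) O)}

theorem sum_smul_mem_of_det (hϖ : maximalIdeal O = span {ϖ}) (hϖ0 : ϖ ≠ 0)
    (hF : ∀ i, F i = ∑ j, A i j * X j) (hreg : RegSeqMod (span {C ϖ}) (List.ofFn F))
    (ψ : MvPowerSeries (Fin n) O →ₐ[O] T) (hψF : ∀ i, ψ (F i) = 0) {m : Fin d → M}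
    (hdet : ∀ (c : Fin d → O) (y : M), ∑ i, c i • ψ A.det • m i = ϖ • y → ∀ i, ϖ ∣ c i)
    [Module.IsTorsionFree O M] (r : Fin d → MvPowerSeries (Fin n) O) :
    ((∃ y, ∑ i, ψ (r i) • m i = ϖ • y) → ∀ i, r i ∈ span {C ϖ} ⊔ span (Set.range F)) ∧
      (∑ i, ψ (r i) • m i = 0 → ∀ i, r i ∈ span (Set.range F)) := by
  let W₀ : Submodule (MvPowerSeries (Fin n) O) (Fin d → MvPowerSeries (Fin n) O) :=
    { carrier := {r | ∑ i, ψ (r i) • m i = 0}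
      zero_mem' := by simp
      add_mem' := fun {r s} hr hs ↦ by
        simp only [Set.mem_ofPred_eq, Pi.add_apply, map_add, add_smul, Finset.sum_add_distrib] at *
        rw [hr, hs, add_zero]
      smul_mem' := fun b r hr ↦ by
        simp only [Set.mem_ofPred_eq, Pi.smul_apply, smul_eq_mul, map_mul, mul_smul,
          ← Finset.smul_sum] at *
        rw [hr, smul_zero] }
  let W : Submodule (MvPowerSeries (Fin n) O) (Fin d → MvPowerSeries (Fin n) O) :=
    { carrier := {r | ∃ y, ∑ i, ψ (r i) • m i = ϖ • y}
      zero_mem' := ⟨0, by simp⟩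
      add_mem' := fun {r s} ⟨y, hr⟩ ⟨z, hs⟩ ↦ ⟨y + z, by
        simp only [Pi.add_apply, map_add, add_smul, Finset.sum_add_distrib]
        rw [hr, hs, smul_add]⟩
      smul_mem' := fun b r ⟨y, hr⟩ ↦ ⟨ψ b • y, by
        simp only [Pi.smul_apply, smul_eq_mul, map_mul, mul_smul, ← Finset.smul_sum]
        rw [hr, smul_comm]⟩ }
  have hF0 : ∀ b ∈ span (Set.range F), ψ b = 0 := by
    intro b hb
    have : span (Set.range F) ≤ RingHom.ker ψ := by
      rw [span_le]
      rintro _ ⟨i, rfl⟩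
      exact hψF i
    exact this hb
  have hψC : ∀ o, ψ (C o) = algebraMap O T o := fun o ↦ ψ.commutes o
  have hW : ∀ r, (∀ i, r i ∈ span {C ϖ} ⊔ span (Set.range F)) → r ∈ W := by
    intro r hr
    have h1 : ∀ i, ∃ c, ψ (r i) = ϖ • c := by
      intro i
      have := hr i
      rw [sup_comm, mem_sup_span_singleton_iff] at this
      obtain ⟨c, hc⟩ := this
      have h2 := hF0 _ hc
      rw [map_sub, sub_eq_zero, map_mul, hψC] at h2
      exact ⟨ψ c, by rw [h2, Algebra.smul_def, mul_comm]⟩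
    choose c hc using h1
    refine ⟨∑ i, c i • m i, ?_⟩
    rw [Finset.smul_sum]
    exact Finset.sum_congr rfl fun i _ ↦ by rw [hc, smul_assoc]
  have hdet' : ∀ c : Fin d → O, (fun i ↦ C (c i) * A.det) ∈ W → ∀ i, ϖ ∣ c i := by
    rintro c ⟨y, hy⟩
    refine hdet c y ?_
    rw [← hy]
    exact Finset.sum_congr rfl fun i _ ↦ by rw [map_mul, hψC, mul_smul, algebraMap_smul]
  refine ⟨fun hr ↦ mem_sup_span_of_mem hϖ hϖ0 hF hreg W hW hdet' hr,
    fun hr ↦ mem_span_of_mem hϖ hϖ0 hF hreg W W₀ hW hdet' ?_ ?_ ?_ hr⟩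
  · exact fun s hs ↦ ⟨0, by rw [smul_zero]; exact hs⟩
  · exact fun s hs ↦ Finset.sum_eq_zero fun i _ ↦ by rw [hF0 _ (hs i), zero_smul]
  · intro s hs
    have h1 : ϖ • ∑ i, ψ (s i) • m i = 0 := by
      rw [← hs, Finset.smul_sum]
      exact Finset.sum_congr rfl fun i _ ↦ by
        rw [Pi.smul_apply, smul_eq_mul, map_mul, hψC, mul_smul, algebraMap_smul]
    exact (smul_eq_zero.1 h1).resolve_left hϖ0

/-- Independence modulo `ϖ` says that the span of the `m i` is saturated: a combination divisible by
`ϖ` has coefficients divisible by `ϖ`. -/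
theorem mem_span_of_smul_mem_span (hϖ : maximalIdeal O = span {ϖ}) (hϖ0 : ϖ ≠ 0)
    (ψ : MvPowerSeries (Fin n) O →ₐ[O] T) (hψ : Function.Surjective ψ) (hψF : ∀ i, ψ (F i) = 0)
    [Module.IsTorsionFree O M] {m : Fin d → M}
    (h : ∀ r : Fin d → MvPowerSeries (Fin n) O, (∃ y, ∑ i, ψ (r i) • m i = ϖ • y) →
      ∀ i, r i ∈ span {C ϖ} ⊔ span (Set.range F))
    {o : O} (ho : o ≠ 0) {y : M} (hy : o • y ∈ Submodule.span T (Set.range m)) :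
    y ∈ Submodule.span T (Set.range m) := by
  have key : ∀ y : M, ϖ • y ∈ Submodule.span T (Set.range m) →
      y ∈ Submodule.span T (Set.range m) := by
    intro y hy
    obtain ⟨t, ht⟩ := (Submodule.mem_span_range_iff_exists_fun T).1 hy
    choose r hr using fun i ↦ hψ (t i)
    have h1 : ∀ i, ∃ c, t i = ϖ • c := by
      intro i
      have := h r ⟨y, by simp only [hr, ht]⟩ i
      rw [sup_comm, mem_sup_span_singleton_iff] at this
      obtain ⟨c, hc⟩ := this
      have h2 : span (Set.range F) ≤ RingHom.ker ψ := by
        rw [span_le]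
        rintro _ ⟨i, rfl⟩
        exact hψF i
      have h3 : ψ (r i - c * C ϖ) = 0 := h2 hc
      have h4 : ψ (C ϖ) = algebraMap O T ϖ := ψ.commutes ϖ
      rw [map_sub, sub_eq_zero, map_mul, hr, h4] at h3
      exact ⟨ψ c, by rw [h3, Algebra.smul_def, mul_comm]⟩
    choose c hc using h1
    have h2 : y = ∑ i, c i • m i := by
      rw [← sub_eq_zero]
      refine (smul_eq_zero.1 ?_).resolve_left hϖ0
      rw [smul_sub, ← ht, Finset.smul_sum, sub_eq_zero]
      exact Finset.sum_congr rfl fun i _ ↦ by rw [hc, smul_assoc]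
    rw [h2]
    exact sum_mem fun i _ ↦ Submodule.smul_mem _ _ (Submodule.subset_span ⟨i, rfl⟩)
  have hirr : Irreducible ϖ := (IsDiscreteValuationRing.irreducible_iff_uniformizer ϖ).2 hϖ
  obtain ⟨k, u, rfl⟩ := IsDiscreteValuationRing.eq_unit_mul_pow_irreducible ho hirr
  have h1 : ϖ ^ k • y ∈ Submodule.span T (Set.range m) := by
    have := Submodule.smul_of_tower_mem (Submodule.span T (Set.range m)) (↑u⁻¹ : O) hy
    rwa [smul_smul, ← mul_assoc, Units.inv_mul, one_mul] at this
  clear hy ho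
  induction k with
  | zero => simpa using h1
  | succ k ih =>
    rw [pow_succ', mul_smul] at h1
    exact ih (key _ h1)

end Generation

end

/-! ### The distinguished side and the conclusion. -/

section

section

open IsLocalRing MvPowerSeries Ideal

theorem isLocalRing_of_surjective_algHom {O R T : Type*} [CommRing O] [Nontrivial O] [CommRing R]
    [IsLocalRing R] [CommRing T] [Algebra O R] [Algebra O T] (π : R →ₐ[O] T)
    (hπ : Function.Surjective π) (f : T →ₐ[O] O) : IsLocalRing T :=
  have : Nontrivial T := f.toRingHom.domain_nontrivial
  IsLocalRing.of_surjective' π.toRingHom hπ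

/-- A distinguished quintet has `R ≃ T`, `M` is free over `T`, and the annihilator of the kernel of
an augmentation of `T` is generated by an element computing the length of the cotangent space. -/
theorem AdmissibleQuintet.IsDistinguished.exists_generator {O : Type u} [CommRing O] [IsDomain O]
    [IsDiscreteValuationRing O] [IsAdicComplete (maximalIdeal O) O]
    {Q : AdmissibleQuintet.{u, v₁, v₂, v₃} O} (hQ : Q.IsDistinguished) [IsReduced Q.T]
    (f : Q.T →ₐ[O] O) :
    Module.Free Q.T Q.M ∧ ∃ δ : Q.T, (∀ t ∈ RingHom.ker f, t * δ = 0) ∧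
      (∀ s, (∀ t ∈ RingHom.ker f, t * s = 0) → ∃ r : O, s = r • δ) ∧ f δ ≠ 0 ∧
      Module.length O (RingHom.ker (f.comp Q.π)).Cotangent ≤ Ring.ord O (f δ) := by
  have := hQ.nontrivial
  have hbij : Function.Bijective Q.π :=
    ⟨injective_of_free_compHom (Q.π : Q.R →+* Q.T) hQ.free, Q.π_surjective⟩
  let e := AlgEquiv.ofBijective Q.π hbij
  have : Module.Finite O Q.R := Module.Finite.equiv e.symm.toLinearEquiv
  have : IsReduced Q.R := isReduced_of_injective Q.π hbij.1
  obtain ⟨δ, h1, h2, h3, h4⟩ := hQ.completeIntersection.exists_generator_annihilator_ker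
    (f.comp Q.π)
  refine ⟨(Module.free_compHom_iff (Q.π : Q.R →+* Q.T) hbij).1 hQ.free, Q.π δ, fun t ht ↦ ?_,
    fun s hs ↦ ?_, h3, h4⟩
  · obtain ⟨t, rfl⟩ := hbij.2 t
    rw [← map_mul, h1 t ht, map_zero]
  · obtain ⟨s, rfl⟩ := hbij.2 s
    obtain ⟨r, rfl⟩ := h2 s fun t ht ↦ hbij.1 (by rw [map_mul, map_zero]; exact hs _ ht)
    exact ⟨r, map_smul _ _ _⟩

end

theorem mainTheorem6
    {O : Type u} [CommRing O] [IsDomain O] [IsDiscreteValuationRing O]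
    [IsAdicComplete (IsLocalRing.maximalIdeal O) O]
    {E : Type*} [Field E] [Algebra O E] [IsFractionRing O E]
    (Q' : AdmissibleQuintet.{u, w₁, w₂, w₃} O) (Q : AdmissibleQuintet.{u, v₁, v₂, v₃} O)
    (φ : AdmissibleQuintet.Hom Q' Q)
    (fT : Q.T →ₐ[O] O)
    (hQ : Q.IsDistinguished)
    (hT : IsReduced Q.T) (hT' : IsReduced Q'.T)
    (hfree : Module.Free (Q'.T ⊗[O] E) ((Q'.T ⊗[O] E) ⊗[Q'.T] Q'.M))
    (hrank : Module.finrank (Q'.T ⊗[O] E) ((Q'.T ⊗[O] E) ⊗[Q'.T] Q'.M) =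
      Module.finrank Q.T Q.M)
    (Δ : Q.T) (hΔ : Δ ∈ nonZeroDivisors Q.T)
    (hξ : Set.range (fun x : Q.M => φ.ξDual (φ.ξ x)) = Set.range (fun x : Q.M => Δ • x))
    (hlength :
      Module.length O (RingHom.ker ((fT.comp φ.β).comp Q'.π)).Cotangent ≤
        Module.length O (RingHom.ker (fT.comp Q.π)).Cotangent +
          Module.length O (O ⧸ Ideal.span {fT Δ})) :
    Q'.IsDistinguished ∧ Function.Bijective Q'.π ∧ Module.Free Q'.T Q'.M := by
  obtain ⟨ϖ, hirr⟩ := IsDiscreteValuationRing.exists_irreducible O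
  have hϖ := hirr.maximalIdeal_eq
  have hϖ0 := hirr.ne_zero
  have := hQ.nontrivial
  have : Nontrivial Q.T := fT.toRingHom.domain_nontrivial
  have : IsLocalRing Q'.T := isLocalRing_of_surjective_algHom Q'.π Q'.π_surjective (fT.comp φ.β)
  have : Nontrivial (Q'.T ⊗[O] E) := nontrivial_tensorProduct (fT.comp φ.β)
  have : Module.Free O Q.T := Module.free_of_flat_of_isLocalRing
  obtain ⟨_, δ, hδ, hδgen, hfδ, hlen⟩ := hQ.exists_generator fT
  obtain ⟨χ, hχ⟩ := exists_linearMap_apply_eq_one_of_annihilator hϖ hϖ0 fT hδ hδgen hfδ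
  have hfΔ : fT Δ ≠ 0 := by
    intro h0
    have h1 := (mem_nonZeroDivisors_iff.1 hΔ).1 δ (hδ Δ h0)
    rw [h1, map_zero] at hfδ
    exact hfδ rfl
  -- This also bounds the cotangent length by a finite number, as the presentation of `Q'.R`
  -- requires.
  have hle : Module.length O (RingHom.ker ((fT.comp φ.β).comp Q'.π)).Cotangent ≤
      Ring.ord O (fT δ * fT Δ) := by
    rw [Ring.ord_mul' _ (mem_nonZeroDivisors_of_ne_zero hfδ)]
    exact hlength.trans (add_le_add_left hlen _)
  obtain ⟨n, Θ, a, F, A, hΘ, hX, ha, hord, hF, hA, hreg, hFT, hFR⟩ := exists_presentation hϖ Q'.π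
    Q'.π_surjective (fT.comp φ.β)
    (ne_top_of_le_ne_top (Ring.ord_ne_top (mem_nonZeroDivisors_of_ne_zero (mul_ne_zero hfδ hfΔ))) hle)
  rw [← hord, Ring.ord_eq_addVal, Ring.ord_eq_addVal,
    IsDiscreteValuationRing.addVal_le_iff_dvd] at hle
  let ψ : MvPowerSeries (Fin n) O →ₐ[O] Q'.T := Q'.π.comp Θ
  have hψ : Function.Surjective ψ := Q'.π_surjective.comp hΘ
  have hψf : ∀ b, fT (φ.β (ψ b)) = MvPowerSeries.constantCoeff b :=
    MvPowerSeries.algHom_eq_constantCoeff ((fT.comp φ.β).comp ψ) hX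
  have hFψ : Ideal.span (Set.range F) ≤ RingHom.ker ψ := by
    rw [Ideal.span_le]
    rintro _ ⟨i, rfl⟩
    exact hFT i
  have hD : ∀ t ∈ RingHom.ker (fT.comp φ.β), t * ψ A.det = 0 := by
    intro t ht
    obtain ⟨b, rfl⟩ := hψ t
    have hb : b ∈ Ideal.span (Set.range MvPowerSeries.X) := by
      rw [MvPowerSeries.mem_span_range_X_iff, ← hψf]
      exact ht
    obtain ⟨c, rfl⟩ := Ideal.mem_span_range_iff_exists_fun.1 hb
    rw [← map_mul, Finset.sum_mul]
    refine hFψ (sum_mem fun j _ ↦ ?_)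
    rw [mul_assoc, mul_comm (MvPowerSeries.X j)]
    exact Ideal.mul_mem_left _ _ (det_mul_mem_span_range (fun i ↦ (hF i).symm) j)
  have hfD : fT (φ.β (ψ A.det)) = ∏ i, a i := by
    rw [hψf, RingHom.map_det, ← Matrix.det_diagonal]
    congr 1
    ext i j
    exact hA i j
  obtain ⟨s, hs⟩ := hδgen (φ.β (ψ A.det)) fun t ht ↦ by
    obtain ⟨t, rfl⟩ := φ.β_surjective t
    rw [← map_mul, hD t ht, map_zero]
  rw [hs, map_smul, smul_eq_mul] at hfD
  have hs0 : s ≠ 0 := by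
    rintro rfl
    rw [zero_mul] at hfD
    exact Finset.prod_ne_zero_iff.2 (fun i _ ↦ ha i) hfD.symm
  -- The bound says that `∏ a_i = s fT(δ)` divides `fT(δ) fT(Δ)`.
  have hsΔ : s ∣ fT Δ := by
    rw [← hfD, mul_comm (fT δ)] at hle
    exact (mul_dvd_mul_iff_right hfδ).1 hle
  let e := Module.finBasis Q.T Q.M
  obtain ⟨m, hm⟩ := φ.exists_pairing_ξ_smul_basis e χ hχ
  have hξ' : ∀ y, ∃ z, φ.ξDual (φ.ξ y) = Δ • z := by
    intro y
    have h1 : φ.ξDual (φ.ξ y) ∈ Set.range (fun x : Q.M => Δ • x) := hξ ▸ ⟨y, rfl⟩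
    obtain ⟨z, hz⟩ := h1
    exact ⟨z, hz.symm⟩
  have hmem := sum_smul_mem_of_det hϖ hϖ0 hF hreg ψ hFT (m := m)
    fun c y hcy ↦ φ.dvd_of_sum_smul_eq_smul fT hrank e hδ hm hΔ hξ' hD hs0 hs hsΔ hϖ0 hcy
  have hli : LinearIndependent Q'.T m := by
    rw [Fintype.linearIndependent_iff]
    intro t ht i
    choose r hr using fun i ↦ hψ (t i)
    rw [← hr]
    exact hFψ ((hmem r).2 (by simpa only [hr] using ht) i)
  have hspan : ⊤ ≤ Submodule.span Q'.T (Set.range m) := by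
    intro y _
    obtain ⟨o, ho, hoy⟩ := hli.exists_smul_mem_span hrank y
    exact mem_span_of_smul_mem_span hϖ hϖ0 ψ hψ hFT (fun r ↦ (hmem r).1) ho hoy
  have hT'free : Module.Free Q'.T Q'.M := Module.Free.of_basis (Module.Basis.mk hli hspan)
  have hkerψ : RingHom.ker ψ ≤ Ideal.span (Set.range F) := by
    intro b hb
    -- As `M` is nonzero, `d > 0`, so the relation with all coefficients equal to `b` detects `b`.
    obtain ⟨i⟩ := e.index_nonempty
    refine (hmem fun _ ↦ b).2 ?_ i
    rw [RingHom.mem_ker] at hb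
    simp [hb]
  have hΘψ : RingHom.ker Θ ≤ RingHom.ker ψ := by
    intro b hb
    rw [RingHom.mem_ker] at hb ⊢
    exact (congrArg Q'.π hb).trans (map_zero _)
  have hFΘ : Ideal.span (Set.range F) ≤ RingHom.ker Θ :=
    MvPowerSeries.span_le_of_sub_mem_sq hF ha hA (hΘψ.trans hkerψ) hFR
  have hbij : Function.Bijective Q'.π := by
    refine ⟨(injective_iff_map_eq_zero _).2 fun r hr ↦ ?_, Q'.π_surjective⟩
    obtain ⟨b, rfl⟩ := hΘ r
    exact hFΘ (hkerψ hr)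
  refine ⟨⟨⟨n, List.ofFn F, isRegular_ofFn hϖ hϖ0 hF hreg, ⟨?_⟩⟩, φ.ξ_injective.nontrivial,
    (Module.free_compHom_iff (Q'.π : Q'.R →+* Q'.T) hbij).2 hT'free⟩, hbij, hT'free⟩
  have hker : Ideal.ofList (List.ofFn F) = RingHom.ker Θ := by
    rw [Ideal.ofList_ofFn]
    exact le_antisymm hFΘ (hΘψ.trans hkerψ)
  exact (Ideal.quotientEquivAlgOfEq O hker).trans
    (Ideal.quotientKerAlgEquivOfSurjective hΘ)

end
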